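/- **Setting.** Let $\mathsf{N_C}$ and $\mathsf{N_R}$ be disjoint countably infinite sets of concept names and role names, and let $n\in\mathbb N$, $I=\{1,\dots,n\}$. Concepts are $C ::= A \mid \neg C \mid C\sqcap C \mid \exists r.C \mid \Box_i C$ and formulas are $\varphi ::= C\sqsubseteq D \mid \neg\varphi \mid \varphi\wedge\varphi \mid \Box_i\varphi$ (with $A\in\mathsf{N_C}$, $r\in\mathsf{N_R}$, $i\in I$); $\bot := A\sqcap\neg A$ for a fixed $A$, $\top:=\neg\bot$, and $\sqcup,\forall r,\vee,\Diamond_i$ are the duals of $\sqcap,\exists r,\wedge,\Box_i$. A *frame* is a non-empty set $\mathcal W$ of worlds with functions $\mathcal N_i:\mathcal W\to 2^{2^{\mathcal W}}$, $i\in I$. A (varying domain) *model* consists of a frame and, for each world $w$, a non-empty domain $\Delta_w$, sets $A^{w}\subseteq\Delta_w$ and relations $r^{w}\subseteq\Delta_w\times\Delta_w$; domains of different worlds may differ and may overlap. Concepts are interpreted by $(\neg D)^w=\Delta_w\setminus D^w$, $(D\sqcap E)^w=D^w\cap E^w$, $(\exists r.D)^w=\{d\in\Delta_w\mid \exists e\in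 D^w,\ (d,e)\in r^w\}$, $(\Box_iD)^w=\{d\in\Delta_w\mid\{v\mid d\in D^v\}\in\mathcal N_i(w)\}$. Formulas are interpreted by $w\models C\sqsubseteq D$ iff $C^w\subseteq D^w$; $w\models\Box_i\psi$ iff $\{v\mid v\models\psi\}\in\mathcal N_i(w)$; and $\neg,\wedge$ as usual. A formula is satisfied in a model if it holds at some world of it. For $\mathbf L\in\{\mathbf E,\mathbf M,\mathbf C,\mathbf N\}$, an *$\mathbf L$-model* is a model whose frame is, respectively: arbitrary ($\mathbf E$); supplemented, i.e. each $\mathcal N_i(w)$ is closed under supersets ($\mathbf M$); closed under binary intersections of elements of each $\mathcal N_i(w)$ ($\mathbf C$); such that $\mathcal W\in\mathcal N_i(w)$ for all $i,w$ ($\mathbf N$). A formula is *$\mathbf L^n_{\mathcal{ALC}}$ satisfiable* if it is satisfied in some $\mathbf L$-model. Each formula $\varphi$ has an equivalent normal form $\varphi^\ast$: every inclusion $C\sqsubseteq D$ with $C\neq\top$ is replaced by $\top\sqsubseteq\neg C\sqcup D$, and the formula and all its concepts are put in negation normal form (over $\neg A,\sqcap,\sqcup,\exists,\forall,\Box_i,\Diamond_i$,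 and $\top\sqsubseteq C$, $\neg(\top\sqsubseteq C)$, $\wedge,\vee,\Box_i,\Diamond_i$). Let $\mathsf{Fg}(\varphi)$ be the finite set consisting of all subformulas and all subconcepts of $\varphi^\ast$ (among them the subconcepts of $\top$, the left-hand side of the inclusions $\top\sqsubseteq C$), the negations, put in negation normal form, of all of these, and all role names occurring in $\varphi^\ast$; $|\mathsf{Fg}(\varphi)|$ is its cardinality. **Corollary (exponential model property).** There are polynomials $p$ and $q$ with natural number coefficients such that for every $n$, every $\mathbf L\in\{\mathbf E,\mathbf M,\mathbf C,\mathbf N\}$ and every $\mathbf L^n_{\mathcal{ALC}}$ satisfiable formula $\varphi$, there is an $\mathbf L$-model (with varying domains) in which $\varphi$ is satisfied, such that - the number of worlds is at most $p(|\mathsf{Fg}(\varphi)|)$ if $\mathbf L\in\{\mathbf E,\mathbf M,\mathbf N\}$, and at most $2^{p(|\mathsf{Fg}(\varphi)|)}$ if $\mathbf L=\mathbf C$; - the domain of each world has at most $2^{q(|\mathsf{Fg}(\varphi)|)}$ elements. -/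

import Mathlib

universe u v

namespace NNMDL

/-! ### Syntax: concepts and formulas of the modal description logic with boxes `□₁, …, □ₙ` -/

/-- Concept names (a countably infinite set). -/
abbrev ConceptName : Type := ℕ

/-- Role names (a countably infinite set, kept apart from the concept names by typing). -/
abbrev RoleName : Type := ℕ

/-- Concepts `C ::= A | ¬C | C ⊓ C | ∃r.C | □ᵢC`. -/
inductive Concept (n : ℕ) : Type
  | atom : ConceptName → Concept n
  | neg : Concept n → Concept n
  | inf : Concept n → Concept n → Concept n
  | ex : RoleName → Concept n → Concept n
  | box : Fin n → Concept n → Concept n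
  deriving DecidableEq

/-- `⊥ := A ⊓ ¬A`, for a fixed concept name `A`. -/
def Concept.bot {n : ℕ} : Concept n := .inf (.atom 0) (.neg (.atom 0))

/-- `⊤ := ¬⊥`. -/
def Concept.top {n : ℕ} : Concept n := .neg .bot

/-- Formulas `φ ::= C ⊑ D | ¬φ | φ ∧ φ | □ᵢφ`. -/
inductive Formula (n : ℕ) : Type
  | ci : Concept n → Concept n → Formula n
  | neg : Formula n → Formula n
  | conj : Formula n → Formula n → Formula n
  | box : Fin n → Formula n → Formula n
  deriving DecidableEq

/-! ### Semantics: neighbourhood frames and varying domain neighbourhood models -/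

/-- A neighbourhood frame: a non-empty set of worlds with `n` neighbourhood functions. -/
structure Frame (n : ℕ) where
  World : Type u
  nonempty : Nonempty World
  nbhd : Fin n → World → Set (Set World)

def Frame.Supplemented {n : ℕ} (F : Frame n) : Prop :=
  ∀ (i : Fin n) (w : F.World) (α β : Set F.World), α ∈ F.nbhd i w → α ⊆ β → β ∈ F.nbhd i w

def Frame.ClosedUnderIntersection {n : ℕ} (F : Frame n) : Prop :=
  ∀ (i : Fin n) (w : F.World) (α β : Set F.World),
    α ∈ F.nbhd i w → β ∈ F.nbhd i w → α ∩ β ∈ F.nbhd i w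

def Frame.ContainsUnit {n : ℕ} (F : Frame n) : Prop :=
  ∀ (i : Fin n) (w : F.World), Set.univ ∈ F.nbhd i w

/-- The four systems. -/
inductive Logic : Type
  | E
  | M
  | C
  | N

/-- The class of frames of each system. -/
def Frame.InClass {n : ℕ} (F : Frame n) : Logic → Prop
  | .E => True
  | .M => F.Supplemented
  | .C => F.ClosedUnderIntersection
  | .N => F.ContainsUnit

/-- A varying domain neighbourhood model. `Elem` is an ambient type in which the domains `dom w` of
the different worlds live, so that one and the same object may belong to several domains. -/
structure Model (n : ℕ) where
  frame : Frame.{u} n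
  Elem : Type v
  dom : frame.World → Set Elem
  dom_nonempty : ∀ w, (dom w).Nonempty
  conc : frame.World → ConceptName → Set Elem
  conc_subset : ∀ w A, conc w A ⊆ dom w
  role : frame.World → RoleName → Set (Elem × Elem)
  role_subset : ∀ w r, role w r ⊆ dom w ×ˢ dom w

/-- The interpretation of a concept in a world. -/
def Model.ext {n : ℕ} (M : Model n) : Concept n → M.frame.World → Set M.Elem
  | .atom A, w => M.conc w A
  | .neg C, w => M.dom w \ M.ext C w
  | .inf C D, w => M.ext C w ∩ M.ext D w
  | .ex r C, w => {d | d ∈ M.dom w ∧ ∃ e ∈ M.ext C w, (d, e) ∈ M.role w r}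
  | .box i C, w => {d | d ∈ M.dom w ∧ {v | d ∈ M.ext C v} ∈ M.frame.nbhd i w}

/-- Truth of a formula in a world, `M, w ⊨ φ`. -/
def Model.Sat {n : ℕ} (M : Model n) : Formula n → M.frame.World → Prop
  | .ci C D, w => M.ext C w ⊆ M.ext D w
  | .neg φ, w => ¬ M.Sat φ w
  | .conj φ ψ, w => M.Sat φ w ∧ M.Sat ψ w
  | .box i φ, w => {v | M.Sat φ v} ∈ M.frame.nbhd i w

/-- `φ` is satisfied in `M`. -/
def Model.Satisfies {n : ℕ} (M : Model n) (φ : Formula n) : Prop :=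
  ∃ w : M.frame.World, M.Sat φ w

/-- `φ` is satisfied in some varying domain model based on a frame of the class of `L`. -/
def Satisfiable {n : ℕ} (L : Logic) (φ : Formula n) : Prop :=
  ∃ M : Model.{u, v} n, M.frame.InClass L ∧ M.Satisfies φ

/-! ### Normal form -/

/-- Concepts in negation normal form; here `⊔`, `∀r` and `◇ᵢ` are treated as connectives. -/
inductive NConcept (n : ℕ) : Type
  | atom : ConceptName → NConcept n
  | natom : ConceptName → NConcept n
  | inf : NConcept n → NConcept n → NConcept n
  | sup : NConcept n → NConcept n → NConcept n
  | ex : RoleName → NConcept n → NConcept n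
  | all : RoleName → NConcept n → NConcept n
  | box : Fin n → NConcept n → NConcept n
  | dia : Fin n → NConcept n → NConcept n
  deriving DecidableEq

/-- The negation of a concept, put in negation normal form. -/
def NConcept.dual {n : ℕ} : NConcept n → NConcept n
  | .atom A => .natom A
  | .natom A => .atom A
  | .inf C D => .sup C.dual D.dual
  | .sup C D => .inf C.dual D.dual
  | .ex r C => .all r C.dual
  | .all r C => .ex r C.dual
  | .box i C => .dia i C.dual
  | .dia i C => .box i C.dual

/-- The negation normal form of a concept. -/
def Concept.nnf {n : ℕ} : Concept n → NConcept n
  | .atom A => .atom A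
  | .neg C => C.nnf.dual
  | .inf C D => .inf C.nnf D.nnf
  | .ex r C => .ex r C.nnf
  | .box i C => .box i C.nnf

/-- Formulas in normal form: they are in negation normal form, all concept inclusions have the form
`⊤ ⊑ C`, and all concepts are in negation normal form. `gci C` is `⊤ ⊑ C`, `ngci C` is
`¬(⊤ ⊑ C)`. -/
inductive NFormula (n : ℕ) : Type
  | gci : NConcept n → NFormula n
  | ngci : NConcept n → NFormula n
  | conj : NFormula n → NFormula n → NFormula n
  | disj : NFormula n → NFormula n → NFormula n
  | box : Fin n → NFormula n → NFormula n
  | dia : Fin n → NFormula n → NFormula n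
  deriving DecidableEq

/-- The negation of a formula, put in negation normal form. -/
def NFormula.dual {n : ℕ} : NFormula n → NFormula n
  | .gci C => .ngci C
  | .ngci C => .gci C
  | .conj φ ψ => .disj φ.dual ψ.dual
  | .disj φ ψ => .conj φ.dual ψ.dual
  | .box i φ => .dia i φ.dual
  | .dia i φ => .box i φ.dual

/-- The normal form of a formula: `C ⊑ D` becomes `⊤ ⊑ ¬C ⊔ D` (it stays `⊤ ⊑ D` if `C` is `⊤`),
and formulas and concepts are put in negation normal form. -/
def Formula.nf {n : ℕ} : Formula n → NFormula n
  | .ci C D => if C = Concept.top then .gci D.nnf else .gci (.sup C.nnf.dual D.nnf)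
  | .neg φ => φ.nf.dual
  | .conj φ ψ => .conj φ.nf ψ.nf
  | .box i φ => .box i φ.nf

/-! ### The closure set `Fg(φ)` -/

/-- The subconcepts of a concept in normal form. -/
def NConcept.subs {n : ℕ} : NConcept n → Finset (NConcept n)
  | .atom A => {.atom A}
  | .natom A => {.natom A, .atom A}
  | .inf C D => insert (.inf C D) (C.subs ∪ D.subs)
  | .sup C D => insert (.sup C D) (C.subs ∪ D.subs)
  | .ex r C => insert (.ex r C) C.subs
  | .all r C => insert (.all r C) C.subs
  | .box i C => insert (.box i C) C.subs
  | .dia i C => insert (.dia i C) C.subs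

/-- The role names occurring in a concept. -/
def NConcept.rol {n : ℕ} : NConcept n → Finset RoleName
  | .atom _ => ∅
  | .natom _ => ∅
  | .inf C D => C.rol ∪ D.rol
  | .sup C D => C.rol ∪ D.rol
  | .ex r C => insert r C.rol
  | .all r C => insert r C.rol
  | .box _ C => C.rol
  | .dia _ C => C.rol

/-- `for(φ)`: the subformulas of `φ`. -/
def NFormula.subs {n : ℕ} : NFormula n → Finset (NFormula n)
  | .gci C => {.gci C}
  | .ngci C => {.ngci C, .gci C}
  | .conj φ ψ => insert (.conj φ ψ) (φ.subs ∪ ψ.subs)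
  | .disj φ ψ => insert (.disj φ ψ) (φ.subs ∪ ψ.subs)
  | .box i φ => insert (.box i φ) φ.subs
  | .dia i φ => insert (.dia i φ) φ.subs

/-- `con(φ)`: the subconcepts of `φ` (among them `⊤`, from the inclusions `⊤ ⊑ C`). -/
def NFormula.con {n : ℕ} : NFormula n → Finset (NConcept n)
  | .gci C => Concept.top.nnf.subs ∪ C.subs
  | .ngci C => Concept.top.nnf.subs ∪ C.subs
  | .conj φ ψ => φ.con ∪ ψ.con
  | .disj φ ψ => φ.con ∪ ψ.con
  | .box _ φ => φ.con
  | .dia _ φ => φ.con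

/-- `rol(φ)`: the role names occurring in `φ`. -/
def NFormula.rol {n : ℕ} : NFormula n → Finset RoleName
  | .gci C => C.rol
  | .ngci C => C.rol
  | .conj φ ψ => φ.rol ∪ ψ.rol
  | .disj φ ψ => φ.rol ∪ ψ.rol
  | .box _ φ => φ.rol
  | .dia _ φ => φ.rol

/-- `Fg(φ)` for `φ` in normal form: the subformulas, the subconcepts, their negations in negation
normal form, and the role names. The three kinds of expressions form a disjoint union. -/
def NFormula.Fg {n : ℕ} (φ : NFormula n) : Finset (NFormula n ⊕ (NConcept n ⊕ RoleName)) :=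
  (φ.subs ∪ φ.subs.image NFormula.dual).disjSum
    ((φ.con ∪ φ.con.image NConcept.dual).disjSum φ.rol)

/-- `Fg(φ)` for an arbitrary formula, computed from its normal form. -/
def Formula.Fg {n : ℕ} (φ : Formula n) : Finset (NFormula n ⊕ (NConcept n ⊕ RoleName)) :=
  φ.nf.Fg

end NNMDL

namespace NNMDL

/-! ### Semantics of normal forms -/

/-! Satisfaction of `φ` involves only propositions of two kinds: truth of a formula from a finite
closed set `sf`, and membership of an object in a concept from a finite closed set `sc`. The small
model is a `Collapse` of the given model `M`: each new world copies a world of `M`, and each object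
denotes at each new world an element of `M` or is absent; its denotations at different worlds may be
unrelated. For a proposition `Y`, `after Y` is the set of new worlds where it holds, and `before w
Y` the set of worlds of `M` where it holds when its object is read as the element denoted at `w`. If
`after Y ∈ N i w` exactly when `before w Y` is a neighbourhood in `M`, then truth is preserved
(`Faithful.mem_nExt_iff`, `Faithful.nSat_iff`). The obstacle is that different propositions may have
the same `after` but different `before`.

Varying domains remove it. Suppose that for every pattern of true and false expressions realized in
`M`, and all objects `f ≠ g`, some new world has `f` realizing the pattern and `g` absent
(`Separates`). Then `after Y ⊆ after Z` forces `before w Y ⊆ before w Z` at every `w`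
(`not_after_subset`), which settles E, M and N. Patterns with at most one true and one false
expression suffice, and there are polynomially many. Objects are types with a tag, exponentially
many, but any two differ in one of linearly many atomic properties, so polynomially many worlds
separate them all.

For C, the sets `after Y` of several neighbourhoods may have empty intersection by accident, when
they speak of different objects. So each world gets children that copy a world of `M` in the
intersection of the relevant neighbourhoods, with objects keeping their elements (`HasWitness`). To
bound the height of these trees, `M` is first stratified into as many levels as the modal depth
requires (`Model.strat`). Patterns now need arbitrary sets of true expressions; together with the
trees this costs exponentially many worlds. -/

/-- The interpretation of a concept in negation normal form. -/
def Model.nExt {n : ℕ} (M : Model.{u, v} n) : NConcept n → M.frame.World → Set M.Elem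
  | .atom A, w => M.conc w A
  | .natom A, w => M.dom w \ M.conc w A
  | .inf C D, w => M.nExt C w ∩ M.nExt D w
  | .sup C D, w => M.nExt C w ∪ M.nExt D w
  | .ex r C, w => {d | d ∈ M.dom w ∧ ∃ e ∈ M.nExt C w, (d, e) ∈ M.role w r}
  | .all r C, w => {d | d ∈ M.dom w ∧ ∀ e, (d, e) ∈ M.role w r → e ∈ M.nExt C w}
  | .box i C, w => {d | d ∈ M.dom w ∧ {v | d ∈ M.nExt C v} ∈ M.frame.nbhd i w}
  | .dia i C, w => {d | d ∈ M.dom w ∧ {v | d ∈ M.dom v \ M.nExt C v} ∉ M.frame.nbhd i w}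

/-- Truth of a formula in normal form. -/
def Model.nSat {n : ℕ} (M : Model.{u, v} n) : NFormula n → M.frame.World → Prop
  | .gci C, w => M.dom w ⊆ M.nExt C w
  | .ngci C, w => ¬ M.dom w ⊆ M.nExt C w
  | .conj φ ψ, w => M.nSat φ w ∧ M.nSat ψ w
  | .disj φ ψ, w => M.nSat φ w ∨ M.nSat ψ w
  | .box i φ, w => {v | M.nSat φ v} ∈ M.frame.nbhd i w
  | .dia i φ, w => {v | ¬ M.nSat φ v} ∉ M.frame.nbhd i w

variable {n : ℕ} (M : Model.{u, v} n)

theorem Model.ext_subset_dom (C : Concept n) (w : M.frame.World) : M.ext C w ⊆ M.dom w := by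
  induction C with
  | atom A => exact M.conc_subset w A
  | neg C _ => exact Set.sdiff_subset
  | inf C D hC _ => exact Set.inter_subset_left.trans hC
  | ex r C _ => exact fun d hd => hd.1
  | box i C _ => exact fun d hd => hd.1

theorem Model.nExt_subset_dom (C : NConcept n) (w : M.frame.World) : M.nExt C w ⊆ M.dom w := by
  induction C with
  | atom A => exact M.conc_subset w A
  | natom A => exact Set.sdiff_subset
  | inf C D hC _ => exact Set.inter_subset_left.trans hC
  | sup C D hC hD => exact Set.union_subset hC hD
  | ex r C _ => exact fun d hd => hd.1
  | all r C _ => exact fun d hd => hd.1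
  | box i C _ => exact fun d hd => hd.1
  | dia i C _ => exact fun d hd => hd.1

theorem Model.nExt_dual (C : NConcept n) (w : M.frame.World) :
    M.nExt C.dual w = M.dom w \ M.nExt C w := by
  induction C generalizing w with
  | atom A => rfl
  | natom A => simp [NConcept.dual, nExt, Set.inter_eq_right.2 (M.conc_subset w A)]
  | inf C D hC hD => simp only [NConcept.dual, nExt, hC, hD, Set.sdiff_inter]
  | sup C D hC hD => simp only [NConcept.dual, nExt, hC, hD, Set.sdiff_inter_sdiff]
  | ex r C hC =>
    ext d
    simp only [NConcept.dual, nExt, hC, Set.mem_ofPred_eq, Set.mem_sdiff]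
    refine and_congr_right fun hd => ⟨?_, ?_⟩
    · rintro h ⟨-, e, he, hr⟩
      exact (h e hr).2 he
    · intro h e hr
      exact ⟨(M.role_subset w r hr).2, fun he => h ⟨hd, e, he, hr⟩⟩
  | all r C hC =>
    ext d
    simp only [NConcept.dual, nExt, hC, Set.mem_ofPred_eq, Set.mem_sdiff]
    refine and_congr_right fun hd => ⟨?_, ?_⟩
    · rintro ⟨e, he, hr⟩ h
      exact he.2 (h.2 e hr)
    · intro h
      by_contra hc
      refine h ⟨hd, fun e hr => ?_⟩
      by_contra he
      exact hc ⟨e, ⟨(M.role_subset w r hr).2, he⟩, hr⟩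
  | box i C hC =>
    ext d
    have h : {v | d ∈ M.dom v \ (M.dom v \ M.nExt C v)} = {v | d ∈ M.nExt C v} := by
      ext v
      have := @M.nExt_subset_dom _ C v d
      simp only [Set.mem_sdiff, Set.mem_ofPred_eq]
      tauto
    simp only [NConcept.dual, nExt, hC]
    rw [Set.mem_ofPred_eq, h]
    simp only [Set.mem_ofPred_eq, Set.mem_sdiff]
    tauto
  | dia i C hC =>
    ext d
    simp only [NConcept.dual, nExt, hC]
    simp only [Set.mem_ofPred_eq, Set.mem_sdiff]
    tauto

theorem Model.nExt_nnf (C : Concept n) (w : M.frame.World) : M.nExt C.nnf w = M.ext C w := by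
  induction C generalizing w with
  | atom A => rfl
  | neg C hC => simp only [Concept.nnf, nExt_dual, hC, ext]
  | inf C D hC hD => simp only [Concept.nnf, nExt, hC, hD, ext]
  | ex r C hC => simp only [Concept.nnf, nExt, hC, ext]
  | box i C hC => simp only [Concept.nnf, nExt, hC, ext]

theorem Model.nSat_dual (φ : NFormula n) (w : M.frame.World) :
    M.nSat φ.dual w ↔ ¬ M.nSat φ w := by
  induction φ generalizing w with
  | gci C => rfl
  | ngci C => simp [NFormula.dual, nSat]
  | conj φ ψ h₁ h₂ => simp only [NFormula.dual, nSat, h₁, h₂]; tauto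
  | disj φ ψ h₁ h₂ => simp only [NFormula.dual, nSat, h₁, h₂]; tauto
  | box i φ h => simp only [NFormula.dual, nSat, h, not_not]
  | dia i φ h => simp only [NFormula.dual, nSat, h, not_not]

theorem Model.ext_top (w : M.frame.World) : M.ext Concept.top w = M.dom w := by
  simp only [Concept.top, Concept.bot, ext]
  ext d
  simp only [Set.mem_sdiff, Set.mem_inter_iff]
  tauto

theorem Model.nSat_nf (φ : Formula n) (w : M.frame.World) : M.nSat φ.nf w ↔ M.Sat φ w := by
  induction φ generalizing w with
  | ci C D =>
    by_cases h : C = Concept.top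
    · subst h
      simp only [Formula.nf, if_true, nSat, Sat, ext_top, nExt_nnf]
    · simp only [Formula.nf, if_neg h, nSat, Sat, nExt, nExt_dual, nExt_nnf]
      constructor
      · intro hs d hd
        exact (hs (M.ext_subset_dom C w hd)).resolve_left fun h' => h'.2 hd
      · intro hs d hd
        by_cases hc : d ∈ M.ext C w
        · exact Or.inr (hs hc)
        · exact Or.inl ⟨hd, hc⟩
  | neg φ h => simp only [Formula.nf, nSat_dual, h, Sat]
  | conj φ ψ h₁ h₂ => simp only [Formula.nf, nSat, h₁, h₂, Sat]
  | box i φ h => simp only [Formula.nf, nSat, h, Sat]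

/-! ### Closure sets -/

theorem NConcept.dual_dual (C : NConcept n) : C.dual.dual = C := by
  induction C <;> simp_all [NConcept.dual]

theorem NFormula.dual_dual (φ : NFormula n) : φ.dual.dual = φ := by
  induction φ <;> simp_all [NFormula.dual]

theorem NConcept.mem_subs_self (C : NConcept n) : C ∈ C.subs := by
  cases C <;> simp [NConcept.subs]

theorem NFormula.mem_subs_self (φ : NFormula n) : φ ∈ φ.subs := by
  cases φ <;> simp [NFormula.subs]

theorem NConcept.subs_trans {C D E : NConcept n} (h₁ : C ∈ D.subs) (h₂ : D ∈ E.subs) :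
    C ∈ E.subs := by
  induction E with
  | atom A | natom A =>
    simp only [NConcept.subs, Finset.mem_insert, Finset.mem_singleton] at h₂
    rcases h₂ with rfl | rfl <;> simp_all [NConcept.subs]
  | _ =>
    simp only [NConcept.subs, Finset.mem_insert, Finset.mem_union] at h₂ ⊢
    grind [NConcept.subs]

theorem NFormula.subs_trans {φ ψ χ : NFormula n} (h₁ : φ ∈ ψ.subs) (h₂ : ψ ∈ χ.subs) :
    φ ∈ χ.subs := by
  induction χ with
  | gci A | ngci A =>
    simp only [NFormula.subs, Finset.mem_insert, Finset.mem_singleton] at h₂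
    rcases h₂ with rfl | rfl <;> simp_all [NFormula.subs]
  | _ =>
    simp only [NFormula.subs, Finset.mem_insert, Finset.mem_union] at h₂ ⊢
    grind [NFormula.subs]

theorem NFormula.mem_con_of_mem_subs {C D : NConcept n} {φ : NFormula n} (h₁ : C ∈ D.subs)
    (h₂ : D ∈ φ.con) : C ∈ φ.con := by
  induction φ with
  | gci A | ngci A =>
    simp only [NFormula.con, Finset.mem_union] at h₂ ⊢
    exact h₂.imp (NConcept.subs_trans h₁) (NConcept.subs_trans h₁)
  | _ => simp only [NFormula.con, Finset.mem_union] at h₂ ⊢; tauto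

theorem NFormula.mem_con_of_gci {C : NConcept n} {φ : NFormula n}
    (h : .gci C ∈ φ.subs ∨ .ngci C ∈ φ.subs) : C ∈ φ.con := by
  induction φ with
  | gci A | ngci A =>
    have : C = A := by simpa [NFormula.subs] using h
    subst this
    simp [NFormula.con, NConcept.mem_subs_self]
  | _ =>
    simp only [NFormula.subs, NFormula.con, Finset.mem_union, Finset.mem_insert,
      reduceCtorEq, false_or] at h ⊢
    tauto

/-- Closure conditions on a set `sc` of concepts, a set `sf` of formulas and a set `I` of modal
indices that make the truth of the members of `sc` and `sf` a matter of `sc`, `sf` and `I` only. -/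
structure IsClosed (sc : Finset (NConcept n)) (sf : Finset (NFormula n)) (I : Finset (Fin n)) :
    Prop where
  inf : ∀ {C D}, .inf C D ∈ sc → C ∈ sc ∧ D ∈ sc
  sup : ∀ {C D}, .sup C D ∈ sc → C ∈ sc ∧ D ∈ sc
  ex : ∀ {r C}, .ex r C ∈ sc → C ∈ sc
  all : ∀ {r C}, .all r C ∈ sc → C ∈ sc
  box : ∀ {i C}, .box i C ∈ sc → i ∈ I ∧ C ∈ sc
  dia : ∀ {i C}, .dia i C ∈ sc → i ∈ I ∧ C ∈ sc
  dual : ∀ {C}, C ∈ sc → C.dual ∈ sc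
  gci : ∀ {C}, .gci C ∈ sf → C ∈ sc
  ngci : ∀ {C}, .ngci C ∈ sf → C ∈ sc
  conj : ∀ {φ ψ}, .conj φ ψ ∈ sf → φ ∈ sf ∧ ψ ∈ sf
  disj : ∀ {φ ψ}, .disj φ ψ ∈ sf → φ ∈ sf ∧ ψ ∈ sf
  fbox : ∀ {i φ}, .box i φ ∈ sf → i ∈ I ∧ φ ∈ sf
  fdia : ∀ {i φ}, .dia i φ ∈ sf → i ∈ I ∧ φ ∈ sf
  fdual : ∀ {φ}, φ ∈ sf → φ.dual ∈ sf

/-- The subconcepts of `φ` and their duals. -/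
def NFormula.clCon (φ : NFormula n) : Finset (NConcept n) := φ.con ∪ φ.con.image NConcept.dual

/-- The subformulas of `φ` and their duals. -/
def NFormula.clSubs (φ : NFormula n) : Finset (NFormula n) := φ.subs ∪ φ.subs.image NFormula.dual

/-- The outermost modal index of an expression. -/
def headIndex : NFormula n ⊕ (NConcept n ⊕ RoleName) → Option (Fin n)
  | .inl (.box i _) => some i
  | .inl (.dia i _) => some i
  | .inr (.inl (.box i _)) => some i
  | .inr (.inl (.dia i _)) => some i
  | _ => none

/-- The modal indices occurring in `φ`. -/
def NFormula.indices (φ : NFormula n) : Finset (Fin n) := (φ.Fg.image headIndex).eraseNone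

theorem NFormula.card_indices_le (φ : NFormula n) : φ.indices.card ≤ φ.Fg.card := by
  exact (Finset.card_eraseNone_le _).trans Finset.card_image_le

theorem NFormula.card_cl_le (φ : NFormula n) : φ.clCon.card + φ.clSubs.card ≤ φ.Fg.card := by
  simp only [NFormula.Fg, Finset.card_disjSum, clCon, clSubs]
  omega

theorem NFormula.mem_clCon_dual {φ : NFormula n} {C : NConcept n} (h : C ∈ φ.clCon) :
    C.dual ∈ φ.clCon := by
  simp only [clCon, Finset.mem_union, Finset.mem_image] at h ⊢
  rcases h with h | ⟨D, hD, rfl⟩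
  · exact Or.inr ⟨C, h, rfl⟩
  · exact Or.inl (by rwa [NConcept.dual_dual])

theorem NFormula.mem_clSubs_dual {φ ψ : NFormula n} (h : ψ ∈ φ.clSubs) :
    ψ.dual ∈ φ.clSubs := by
  simp only [clSubs, Finset.mem_union, Finset.mem_image] at h ⊢
  rcases h with h | ⟨D, hD, rfl⟩
  · exact Or.inr ⟨ψ, h, rfl⟩
  · exact Or.inl (by rwa [NFormula.dual_dual])

/-- The hypothesis on duals serves the case where `D` is the dual of some `E ∈ φ.con`: then `C.dual`
is a subconcept of `E`, and `C` is its dual. -/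
theorem NFormula.mem_clCon_of_subs {φ : NFormula n} {C D : NConcept n} (h : D ∈ φ.clCon)
    (h₁ : C ∈ D.subs) (h₂ : C.dual ∈ D.dual.subs) : C ∈ φ.clCon := by
  simp only [clCon, Finset.mem_union, Finset.mem_image] at h
  rcases h with h | ⟨E, hE, rfl⟩
  · exact Finset.mem_union_left _ (NFormula.mem_con_of_mem_subs h₁ h)
  · rw [NConcept.dual_dual] at h₂
    exact Finset.mem_union_right _ (Finset.mem_image.2
      ⟨_, NFormula.mem_con_of_mem_subs h₂ hE, NConcept.dual_dual C⟩)

theorem NFormula.mem_clSubs_of_subs {φ ψ χ : NFormula n} (h : χ ∈ φ.clSubs)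
    (h₁ : ψ ∈ χ.subs) (h₂ : ψ.dual ∈ χ.dual.subs) : ψ ∈ φ.clSubs := by
  simp only [clSubs, Finset.mem_union, Finset.mem_image] at h
  rcases h with h | ⟨E, hE, rfl⟩
  · exact Finset.mem_union_left _ (NFormula.subs_trans h₁ h)
  · rw [NFormula.dual_dual] at h₂
    exact Finset.mem_union_right _ (Finset.mem_image.2
      ⟨_, NFormula.subs_trans h₂ hE, NFormula.dual_dual ψ⟩)

theorem NFormula.mem_indices_of_con {φ : NFormula n} {C : NConcept n} {i : Fin n}
    (h : C ∈ φ.clCon) (hi : headIndex (.inr (.inl C)) = some i) : i ∈ φ.indices := by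
  rw [indices, Finset.mem_eraseNone, Finset.mem_image]
  exact ⟨_, Finset.inr_mem_disjSum.2 (Finset.inl_mem_disjSum.2 h), hi⟩

theorem NFormula.mem_indices_of_subs {φ ψ : NFormula n} {i : Fin n}
    (h : ψ ∈ φ.clSubs) (hi : headIndex (.inl ψ) = some i) : i ∈ φ.indices := by
  rw [indices, Finset.mem_eraseNone, Finset.mem_image]
  exact ⟨_, Finset.inl_mem_disjSum.2 h, hi⟩

theorem NFormula.mem_clCon_of_gci {φ : NFormula n} {C : NConcept n}
    (h : .gci C ∈ φ.clSubs ∨ .ngci C ∈ φ.clSubs) : C ∈ φ.clCon := by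
  refine Finset.mem_union_left _ (NFormula.mem_con_of_gci ?_)
  simp only [clSubs, Finset.mem_union, Finset.mem_image] at h
  rcases h with (h | ⟨E, hE, he⟩) | (h | ⟨E, hE, he⟩)
  · exact Or.inl h
  · rw [← NFormula.dual_dual E, he] at hE
    exact Or.inr hE
  · exact Or.inr h
  · rw [← NFormula.dual_dual E, he] at hE
    exact Or.inl hE

theorem NFormula.isClosed (φ : NFormula n) : IsClosed φ.clCon φ.clSubs φ.indices where
  inf h := ⟨mem_clCon_of_subs h (by simp [NConcept.subs, NConcept.mem_subs_self])
      (by simp [NConcept.subs, NConcept.dual, NConcept.mem_subs_self]),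
    mem_clCon_of_subs h (by simp [NConcept.subs, NConcept.mem_subs_self])
      (by simp [NConcept.subs, NConcept.dual, NConcept.mem_subs_self])⟩
  sup h := ⟨mem_clCon_of_subs h (by simp [NConcept.subs, NConcept.mem_subs_self])
      (by simp [NConcept.subs, NConcept.dual, NConcept.mem_subs_self]),
    mem_clCon_of_subs h (by simp [NConcept.subs, NConcept.mem_subs_self])
      (by simp [NConcept.subs, NConcept.dual, NConcept.mem_subs_self])⟩
  ex h := mem_clCon_of_subs h (by simp [NConcept.subs, NConcept.mem_subs_self])
      (by simp [NConcept.subs, NConcept.dual, NConcept.mem_subs_self])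
  all h := mem_clCon_of_subs h (by simp [NConcept.subs, NConcept.mem_subs_self])
      (by simp [NConcept.subs, NConcept.dual, NConcept.mem_subs_self])
  box h := ⟨mem_indices_of_con h rfl,
    mem_clCon_of_subs h (by simp [NConcept.subs, NConcept.mem_subs_self])
      (by simp [NConcept.subs, NConcept.dual, NConcept.mem_subs_self])⟩
  dia h := ⟨mem_indices_of_con h rfl,
    mem_clCon_of_subs h (by simp [NConcept.subs, NConcept.mem_subs_self])
      (by simp [NConcept.subs, NConcept.dual, NConcept.mem_subs_self])⟩
  dual := mem_clCon_dual
  gci h := mem_clCon_of_gci (Or.inl h)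
  ngci h := mem_clCon_of_gci (Or.inr h)
  conj h := ⟨mem_clSubs_of_subs h (by simp [NFormula.subs, NFormula.mem_subs_self])
      (by simp [NFormula.subs, NFormula.dual, NFormula.mem_subs_self]),
    mem_clSubs_of_subs h (by simp [NFormula.subs, NFormula.mem_subs_self])
      (by simp [NFormula.subs, NFormula.dual, NFormula.mem_subs_self])⟩
  disj h := ⟨mem_clSubs_of_subs h (by simp [NFormula.subs, NFormula.mem_subs_self])
      (by simp [NFormula.subs, NFormula.dual, NFormula.mem_subs_self]),
    mem_clSubs_of_subs h (by simp [NFormula.subs, NFormula.mem_subs_self])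
      (by simp [NFormula.subs, NFormula.dual, NFormula.mem_subs_self])⟩
  fbox h := ⟨mem_indices_of_subs h rfl,
    mem_clSubs_of_subs h (by simp [NFormula.subs, NFormula.mem_subs_self])
      (by simp [NFormula.subs, NFormula.dual, NFormula.mem_subs_self])⟩
  fdia h := ⟨mem_indices_of_subs h rfl,
    mem_clSubs_of_subs h (by simp [NFormula.subs, NFormula.mem_subs_self])
      (by simp [NFormula.subs, NFormula.dual, NFormula.mem_subs_self])⟩
  fdual := mem_clSubs_dual

/-! ### Modal depth and stratified models -/

/-- The modal depth of a concept. -/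
def NConcept.depth : NConcept n → ℕ
  | .atom _ => 0
  | .natom _ => 0
  | .inf C D => max C.depth D.depth
  | .sup C D => max C.depth D.depth
  | .ex _ C => C.depth
  | .all _ C => C.depth
  | .box _ C => C.depth + 1
  | .dia _ C => C.depth + 1

/-- The modal depth of a formula. -/
def NFormula.depth : NFormula n → ℕ
  | .gci C => C.depth
  | .ngci C => C.depth
  | .conj φ ψ => max φ.depth ψ.depth
  | .disj φ ψ => max φ.depth ψ.depth
  | .box _ φ => φ.depth + 1
  | .dia _ φ => φ.depth + 1

theorem NConcept.depth_le_of_mem_subs {C D : NConcept n} (h : C ∈ D.subs) :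
    C.depth ≤ D.depth := by
  induction D with
  | _ =>
    simp only [NConcept.subs, Finset.mem_insert, Finset.mem_union, Finset.mem_singleton] at h
    grind [NConcept.depth]

theorem NFormula.depth_le_of_mem_subs {φ ψ : NFormula n} (h : φ ∈ ψ.subs) :
    φ.depth ≤ ψ.depth := by
  induction ψ with
  | _ =>
    simp only [NFormula.subs, Finset.mem_insert, Finset.mem_union, Finset.mem_singleton] at h
    grind [NFormula.depth]

/-- Prefixing a modal operator adds a concept deeper than all the old subconcepts, hence a new one.
-/
theorem NConcept.depth_le_card (C : NConcept n) : C.depth ≤ C.subs.card := by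
  have mono : ∀ {E D : NConcept n}, E.depth ≤ E.subs.card → E ∈ D.subs →
      E.depth ≤ D.subs.card := fun hE hD =>
    hE.trans (Finset.card_le_card fun _ hx => subs_trans hx hD)
  induction C with
  | atom A | natom A => exact Nat.zero_le _
  | inf C D hC hD | sup C D hC hD =>
    exact max_le (mono hC (by simp [subs, mem_subs_self])) (mono hD (by simp [subs, mem_subs_self]))
  | ex r C hC | all r C hC => exact mono (E := C) hC (by simp [subs, mem_subs_self])
  | box i C hC | dia i C hC =>
    simp only [subs, depth]
    rw [Finset.card_insert_of_notMem]
    · omega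
    · intro h
      have := depth_le_of_mem_subs h
      simp [depth] at this

theorem NFormula.depth_le_card (φ : NFormula n) : φ.depth ≤ φ.con.card + φ.subs.card := by
  induction φ with
  | gci C | ngci C =>
    refine C.depth_le_card.trans (le_trans ?_ (Nat.le_add_right _ _))
    exact Finset.card_le_card (Finset.subset_union_right)
  | conj φ ψ h₁ h₂ | disj φ ψ h₁ h₂ =>
    refine max_le (h₁.trans (add_le_add ?_ ?_)) (h₂.trans (add_le_add ?_ ?_)) <;>
      refine Finset.card_le_card fun x hx => ?_ <;> simp [con, subs, hx]
  | box i φ h | dia i φ h =>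
    simp only [subs, con, depth]
    rw [Finset.card_insert_of_notMem]
    · omega
    · intro h
      have := depth_le_of_mem_subs h
      simp [depth] at this

/-- The model whose worlds are the worlds of `M` with a level at most `K`, where the neighbourhoods
look only at the worlds of the next lower level. -/
def Model.strat (K : ℕ) : Model.{u, v} n where
  frame :=
    { World := M.frame.World × Fin (K + 1)
      nonempty := M.frame.nonempty.map fun w => (w, 0)
      nbhd := fun i w => {α | ∃ j : Fin (K + 1), j.val + 1 = w.2.val ∧
        {v | (v, j) ∈ α} ∈ M.frame.nbhd i w.1} }
  Elem := M.Elem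
  dom w := M.dom w.1
  dom_nonempty w := M.dom_nonempty w.1
  conc w := M.conc w.1
  conc_subset w := M.conc_subset w.1
  role w := M.role w.1
  role_subset w := M.role_subset w.1

theorem Model.mem_strat_nbhd {K : ℕ} {i : Fin n} {w : M.frame.World} {j k : Fin (K + 1)}
    (h : j.val + 1 = k.val) (α : Set (M.frame.World × Fin (K + 1))) :
    α ∈ (M.strat K).frame.nbhd i (w, k) ↔ {v | (v, j) ∈ α} ∈ M.frame.nbhd i w := by
  constructor
  · rintro ⟨j', hj, h'⟩
    obtain rfl : j' = j := Fin.ext (by simp only at hj; omega)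
    exact h'
  · exact fun h' => ⟨j, h, h'⟩

/-- Each modal operator descends one level, so from level `C.depth` on, evaluation never consults
the neighbourhoods at level 0, where there are none. -/
theorem Model.strat_nExt {K : ℕ} (C : NConcept n) (w : M.frame.World) (k : Fin (K + 1))
    (h : C.depth ≤ k.val) : (M.strat K).nExt C (w, k) = M.nExt C w := by
  induction C generalizing w k with
  | atom A | natom A => rfl
  | inf C D hC hD | sup C D hC hD =>
    simp only [NConcept.depth, max_le_iff] at h
    simp only [nExt, hC w k h.1, hD w k h.2]
    rfl
  | ex r C hC | all r C hC =>
    simp only [nExt, hC w k h]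
    rfl
  | box i C hC | dia i C hC =>
    simp only [NConcept.depth] at h
    obtain ⟨j, hj⟩ : ∃ j : Fin (K + 1), j.val + 1 = k.val := ⟨⟨k.val - 1, by omega⟩, by simp; omega⟩
    ext d
    refine and_congr_right fun _ => ?_
    first
    | refine (M.mem_strat_nbhd hj _).trans (iff_of_eq (congrArg (· ∈ M.frame.nbhd i w) ?_))
    | refine not_congr ((M.mem_strat_nbhd hj _).trans
        (iff_of_eq (congrArg (· ∈ M.frame.nbhd i w) ?_)))
    ext v
    first
    | exact iff_of_eq (congrArg (d ∈ ·) (hC v j (by omega)))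
    | exact iff_of_eq (congrArg (d ∈ M.dom v \ ·) (hC v j (by omega)))

theorem Model.strat_nSat {K : ℕ} (φ : NFormula n) (w : M.frame.World) (k : Fin (K + 1))
    (h : φ.depth ≤ k.val) : (M.strat K).nSat φ (w, k) ↔ M.nSat φ w := by
  induction φ generalizing w k with
  | gci C | ngci C =>
    simp only [nSat, M.strat_nExt C w k h]
    rfl
  | conj φ ψ h₁ h₂ | disj φ ψ h₁ h₂ =>
    simp only [NFormula.depth, max_le_iff] at h
    simp only [nSat, h₁ w k h.1, h₂ w k h.2]
  | box i φ ih | dia i φ ih =>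
    simp only [NFormula.depth] at h
    obtain ⟨j, hj⟩ : ∃ j : Fin (K + 1), j.val + 1 = k.val := ⟨⟨k.val - 1, by omega⟩, by simp; omega⟩
    first
    | refine (M.mem_strat_nbhd hj _).trans (iff_of_eq (congrArg (· ∈ M.frame.nbhd i w) ?_))
    | refine not_congr ((M.mem_strat_nbhd hj _).trans
        (iff_of_eq (congrArg (· ∈ M.frame.nbhd i w) ?_)))
    ext v
    first
    | exact ih v j (by omega)
    | exact not_congr (ih v j (by omega))

theorem Model.strat_closedUnderIntersection (K : ℕ) (h : M.frame.ClosedUnderIntersection) :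
    (M.strat K).frame.ClosedUnderIntersection := by
  rintro i ⟨w, k⟩ α β ⟨j, hj, hα⟩ hβ
  exact (M.mem_strat_nbhd hj _).2 (h i w _ _ hα ((M.mem_strat_nbhd hj _).1 hβ))

end NNMDL

namespace NNMDL

/-! ### Collapsed models -/

/-- A blueprint for a model that copies `M`: every world copies a world of `M`, and every object is
at each world a copy of an element of `M`, or does not exist there; up to the concepts in `sc`, all
elements of a world of `M` are represented at its copies. -/
structure Collapse {n : ℕ} (M : Model.{u, v} n) (sc : Finset (NConcept n)) where
  World : Type
  Obj : Type
  nonempty : Nonempty World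
  proj : World → M.frame.World
  el : World → Obj → Option M.Elem
  mem_dom : ∀ {w f d}, el w f = some d → d ∈ M.dom (proj w)
  home : ∀ {w d}, d ∈ M.dom (proj w) → ∃ f d', el w f = some d' ∧
    ∀ C ∈ sc, (d' ∈ M.nExt C (proj w) ↔ d ∈ M.nExt C (proj w))

variable {n : ℕ} {M : Model.{u, v} n} {sc : Finset (NConcept n)} {sf : Finset (NFormula n)}
  {I : Finset (Fin n)}

namespace Collapse

/-- The model described by a blueprint and neighbourhoods for its worlds. -/
def model (K : Collapse M sc) (N : Fin n → K.World → Set (Set K.World)) : Model.{0, 0} n where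
  frame := ⟨K.World, K.nonempty, N⟩
  Elem := K.Obj
  dom w := {f | ∃ d, K.el w f = some d}
  dom_nonempty w := by
    obtain ⟨d, hd⟩ := M.dom_nonempty (K.proj w)
    obtain ⟨f, d', hf, -⟩ := K.home hd
    exact ⟨f, d', hf⟩
  conc w A := {f | ∃ d, K.el w f = some d ∧ d ∈ M.conc (K.proj w) A}
  conc_subset w A := fun f ⟨d, hd, _⟩ => ⟨d, hd⟩
  -- Edges are taken up to equality of `sc`-types at both ends, because `home` represents an element
  -- only by one of the same type.
  role w r := {p | ∃ d₁ d₂ e₁ e₂, K.el w p.1 = some d₁ ∧ K.el w p.2 = some d₂ ∧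
    (∀ C ∈ sc, (d₁ ∈ M.nExt C (K.proj w) ↔ e₁ ∈ M.nExt C (K.proj w))) ∧
    (∀ C ∈ sc, (d₂ ∈ M.nExt C (K.proj w) ↔ e₂ ∈ M.nExt C (K.proj w))) ∧
    (e₁, e₂) ∈ M.role (K.proj w) r}
  role_subset w r := fun _ ⟨d₁, d₂, _, _, h₁, h₂, _⟩ => ⟨⟨d₁, h₁⟩, ⟨d₂, h₂⟩⟩

/-- Propositions about the worlds of a blueprint: a formula is true, or an object belongs to a
concept. -/
abbrev Idx (K : Collapse M sc) (sf : Finset (NFormula n)) : Type :=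
  {ψ // ψ ∈ sf} ⊕ (K.Obj × {C // C ∈ sc})

/-- The worlds of `M` at which a formula is true, or at which the element denoted by an object
belongs to a concept. -/
def _root_.NNMDL.Model.truthSet (M : Model.{u, v} n) {Obj : Type} (e : Obj → Option M.Elem) :
    {ψ // ψ ∈ sf} ⊕ (Obj × {C // C ∈ sc}) → Set M.frame.World
  | .inl ψ => {v | M.nSat ψ.1 v}
  | .inr (f, C) => {v | ∃ d, e f = some d ∧ d ∈ M.nExt C.1 v}

/-- The worlds of `M` with a given property, where an object stands for the element that it copies
at `w`. -/
abbrev before (K : Collapse M sc) (w : K.World) (Y : K.Idx sf) : Set M.frame.World :=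
  M.truthSet (K.el w) Y

/-- The worlds of the blueprint with a given property. -/
def after (K : Collapse M sc) : K.Idx sf → Set K.World
  | .inl ψ => {v | M.nSat ψ.1 (K.proj v)}
  | .inr (f, C) => {v | ∃ d, K.el v f = some d ∧ d ∈ M.nExt C.1 (K.proj v)}

/-- The neighbourhoods `N` agree with those of `M` as far as `sc`, `sf` and `I` can see. -/
def Faithful (K : Collapse M sc) (sf : Finset (NFormula n)) (I : Finset (Fin n))
    (N : Fin n → K.World → Set (Set K.World)) : Prop :=
  ∀ i ∈ I, ∀ (w : K.World) (Y : K.Idx sf),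
    K.after Y ∈ N i w ↔ K.before w Y ∈ M.frame.nbhd i (K.proj w)

/-! ### Faithful neighbourhoods preserve truth. -/

variable {K : Collapse M sc} {N : Fin n → K.World → Set (Set K.World)}

/-- The quantifier cases rest on invariance of `sc` under equality of types. The modal cases are
faithfulness itself; for diamonds it is applied to the dual concept, whose extension is the
complement within the domain. -/
theorem Faithful.mem_nExt_iff (hcl : IsClosed sc sf I) (hN : K.Faithful sf I N)
    {C : NConcept n} (hC : C ∈ sc) (w : K.World) (f : K.Obj) :
    f ∈ (K.model N).nExt C w ↔ ∃ d, K.el w f = some d ∧ d ∈ M.nExt C (K.proj w) := by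
  induction C generalizing w f with
  | atom A => exact Iff.rfl
  | natom A =>
    constructor
    · rintro ⟨⟨d, hd⟩, h⟩
      exact ⟨d, hd, K.mem_dom hd, fun hA => h ⟨d, hd, hA⟩⟩
    · rintro ⟨d, hd, -, h⟩
      refine ⟨⟨d, hd⟩, ?_⟩
      rintro ⟨d', hd', h'⟩
      rw [hd] at hd'
      cases hd'
      exact h h'
  | inf C D ihC ihD =>
    refine (and_congr (ihC (hcl.inf hC).1 w f) (ihD (hcl.inf hC).2 w f)).trans ⟨?_, ?_⟩
    · rintro ⟨⟨d, hd, h⟩, ⟨d', hd', h'⟩⟩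
      rw [hd] at hd'
      cases hd'
      exact ⟨d, hd, h, h'⟩
    · rintro ⟨d, hd, h, h'⟩
      exact ⟨⟨d, hd, h⟩, ⟨d, hd, h'⟩⟩
  | sup C D ihC ihD =>
    refine (or_congr (ihC (hcl.sup hC).1 w f) (ihD (hcl.sup hC).2 w f)).trans ⟨?_, ?_⟩
    · rintro (⟨d, hd, h⟩ | ⟨d, hd, h⟩)
      · exact ⟨d, hd, Or.inl h⟩
      · exact ⟨d, hd, Or.inr h⟩
    · rintro ⟨d, hd, h | h⟩
      · exact Or.inl ⟨d, hd, h⟩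
      · exact Or.inr ⟨d, hd, h⟩
  | ex r C ih =>
    have hC' := hcl.ex hC
    constructor
    · rintro ⟨-, g, hg, d₁, d₂, e₁, e₂, h₁, h₂, ht₁, ht₂, hr⟩
      obtain ⟨d, hd, h⟩ := (ih hC' w g).1 hg
      obtain rfl : d₂ = d := Option.some.inj (h₂.symm.trans hd)
      exact ⟨d₁, h₁, (ht₁ _ hC).2 ⟨(M.role_subset _ _ hr).1, e₂, (ht₂ _ hC').1 h, hr⟩⟩
    · rintro ⟨d, hd, hd', e, he, hr⟩
      obtain ⟨g, e', hg, ht⟩ := K.home (M.role_subset _ _ hr).2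
      exact ⟨⟨d, hd⟩, g, (ih hC' w g).2 ⟨e', hg, (ht C hC').2 he⟩,
        d, e', d, e, hd, hg, fun _ _ => Iff.rfl, ht, hr⟩
  | all r C ih =>
    have hC' := hcl.all hC
    constructor
    · rintro ⟨⟨d, hd⟩, h⟩
      refine ⟨d, hd, K.mem_dom hd, fun e hr => ?_⟩
      obtain ⟨g, e', hg, ht⟩ := K.home (M.role_subset _ _ hr).2
      obtain ⟨d', hd', h'⟩ := (ih hC' w g).1
        (h g ⟨d, e', d, e, hd, hg, fun _ _ => Iff.rfl, ht, hr⟩)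
      obtain rfl : e' = d' := Option.some.inj (hg.symm.trans hd')
      exact (ht C hC').1 h'
    · rintro ⟨d, hd, h⟩
      refine ⟨⟨d, hd⟩, ?_⟩
      rintro g ⟨d₁, d₂, e₁, e₂, h₁, h₂, ht₁, ht₂, hr⟩
      obtain rfl : d = d₁ := Option.some.inj (hd.symm.trans h₁)
      exact (ih hC' w g).2 ⟨d₂, h₂, (ht₂ C hC').2 (((ht₁ _ hC).1 h).2 e₂ hr)⟩
  | box i C ih =>
    obtain ⟨hi, hC'⟩ := hcl.box hC
    have h₁ : {v | f ∈ (K.model N).nExt C v} = K.after (sf := sf) (.inr (f, ⟨C, hC'⟩)) :=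
      Set.ext fun v => ih hC' v f
    have h₂ : ∀ d, K.el w f = some d →
        {v | d ∈ M.nExt C v} = K.before (sf := sf) w (.inr (f, ⟨C, hC'⟩)) := fun d hd =>
      Set.ext fun v => ⟨fun h => ⟨d, hd, h⟩, fun ⟨d', hd', h⟩ => by
        obtain rfl : d = d' := Option.some.inj (hd.symm.trans hd')
        exact h⟩
    constructor
    · rintro ⟨⟨d, hd⟩, h⟩
      refine ⟨d, hd, K.mem_dom hd, ?_⟩
      rw [h₂ d hd, ← hN i hi w, ← h₁]
      exact h
    · rintro ⟨d, hd, hd', h⟩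
      rw [h₂ d hd, ← hN i hi w, ← h₁] at h
      exact ⟨⟨d, hd⟩, h⟩
  | dia i C ih =>
    obtain ⟨hi, hC'⟩ := hcl.dia hC
    have hC'' := hcl.dual hC'
    have h₁ : {v | f ∈ (K.model N).dom v \ (K.model N).nExt C v} =
        K.after (sf := sf) (.inr (f, ⟨C.dual, hC''⟩)) := by
      ext v
      constructor
      · rintro ⟨⟨d, hd⟩, h⟩
        refine ⟨d, hd, ?_⟩
        rw [M.nExt_dual]
        exact ⟨K.mem_dom hd, fun h' => h ((ih hC' v f).2 ⟨d, hd, h'⟩)⟩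
      · rintro ⟨d, hd, h⟩
        rw [M.nExt_dual] at h
        refine ⟨⟨d, hd⟩, fun h' => ?_⟩
        obtain ⟨d', hd', h'⟩ := (ih hC' v f).1 h'
        obtain rfl : d = d' := Option.some.inj (hd.symm.trans hd')
        exact h.2 h'
    have h₂ : ∀ d, K.el w f = some d →
        {v | d ∈ M.dom v \ M.nExt C v} = K.before (sf := sf) w (.inr (f, ⟨C.dual, hC''⟩)) := by
      intro d hd
      ext v
      constructor
      · intro h
        exact ⟨d, hd, by rw [M.nExt_dual]; exact h⟩
      · rintro ⟨d', hd', h⟩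
        obtain rfl : d = d' := Option.some.inj (hd.symm.trans hd')
        rw [M.nExt_dual] at h
        exact h
    constructor
    · rintro ⟨⟨d, hd⟩, h⟩
      refine ⟨d, hd, K.mem_dom hd, ?_⟩
      rw [h₂ d hd, ← hN i hi w, ← h₁]
      exact h
    · rintro ⟨d, hd, hd', h⟩
      rw [h₂ d hd, ← hN i hi w, ← h₁] at h
      exact ⟨⟨d, hd⟩, h⟩

theorem Faithful.dom_subset_iff (hcl : IsClosed sc sf I) (hN : K.Faithful sf I N)
    {C : NConcept n} (hC : C ∈ sc) (w : K.World) :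
    (K.model N).dom w ⊆ (K.model N).nExt C w ↔ M.dom (K.proj w) ⊆ M.nExt C (K.proj w) := by
  constructor
  · intro h d hd
    obtain ⟨f, d', hf, ht⟩ := K.home hd
    obtain ⟨e, he, h'⟩ := (hN.mem_nExt_iff hcl hC w f).1 (h ⟨d', hf⟩)
    obtain rfl : d' = e := Option.some.inj (hf.symm.trans he)
    exact (ht C hC).1 h'
  · rintro h f ⟨d, hd⟩
    exact (hN.mem_nExt_iff hcl hC w f).2 ⟨d, hd, h (K.mem_dom hd)⟩

theorem Faithful.nSat_iff (hcl : IsClosed sc sf I) (hN : K.Faithful sf I N)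
    {ψ : NFormula n} (hψ : ψ ∈ sf) (w : K.World) :
    (K.model N).nSat ψ w ↔ M.nSat ψ (K.proj w) := by
  induction ψ generalizing w with
  | gci C => exact hN.dom_subset_iff hcl (hcl.gci hψ) w
  | ngci C => exact not_congr (hN.dom_subset_iff hcl (hcl.ngci hψ) w)
  | conj φ ψ h₁ h₂ => exact and_congr (h₁ (hcl.conj hψ).1 w) (h₂ (hcl.conj hψ).2 w)
  | disj φ ψ h₁ h₂ => exact or_congr (h₁ (hcl.disj hψ).1 w) (h₂ (hcl.disj hψ).2 w)
  | box i φ ih =>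
    obtain ⟨hi, hφ⟩ := hcl.fbox hψ
    refine Iff.trans ?_ (hN i hi w (.inl ⟨φ, hφ⟩))
    exact iff_of_eq (congrArg (· ∈ N i w) (Set.ext fun v => ih hφ v))
  | dia i φ ih =>
    obtain ⟨hi, hφ⟩ := hcl.fdia hψ
    have h := hN i hi w (.inl ⟨φ.dual, hcl.fdual hφ⟩)
    have h₁ : K.after (sf := sf) (.inl ⟨φ.dual, hcl.fdual hφ⟩) = {v | ¬ (K.model N).nSat φ v} :=
      Set.ext fun v => (M.nSat_dual φ _).trans (not_congr (ih hφ v).symm)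
    have h₂ : K.before (sf := sf) w (.inl ⟨φ.dual, hcl.fdual hφ⟩) = {v | ¬ M.nSat φ v} :=
      Set.ext fun v => M.nSat_dual φ v
    rw [h₁, h₂] at h
    exact not_congr h

/-! ### Separation -/

/-- An expression of `sc` or `sf` holds of an element at a world of `M`. -/
def _root_.NNMDL.Model.Holds (M : Model.{u, v} n) (w : M.frame.World) (d : M.Elem) :
    {C // C ∈ sc} ⊕ {ψ // ψ ∈ sf} → Prop
  | .inl C => d ∈ M.nExt C.1 w
  | .inr ψ => M.nSat ψ.1 w

/-- All expressions in `A` hold of an element, and the expression in `y`, if any, does not. -/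
def _root_.NNMDL.Model.Realizes (M : Model.{u, v} n) (w : M.frame.World) (d : M.Elem)
    (A : Set ({C // C ∈ sc} ⊕ {ψ // ψ ∈ sf})) (y : Option ({C // C ∈ sc} ⊕ {ψ // ψ ∈ sf})) : Prop :=
  (∀ x ∈ A, M.Holds w d x) ∧ ∀ x ∈ y, ¬ M.Holds w d x

/-- If the pattern `A`, `y` is realized in `M`, then any object realizes it at a world where any
other given object does not exist. -/
def Separates (K : Collapse M sc)
    (A : Set ({C // C ∈ sc} ⊕ {ψ // ψ ∈ sf})) (y : Option ({C // C ∈ sc} ⊕ {ψ // ψ ∈ sf})) : Prop :=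
  ∀ w, ∀ d ∈ M.dom w, M.Realizes w d A y → ∀ f g : K.Obj, f ≠ g →
    ∃ w' d', K.el w' f = some d' ∧ M.Realizes (K.proj w') d' A y ∧ K.el w' g = none

/-- All patterns with at most one positive expression are separated. -/
def SeparatesPairs (K : Collapse M sc) (sf : Finset (NFormula n)) : Prop :=
  ∀ A : Set ({C // C ∈ sc} ⊕ {ψ // ψ ∈ sf}), A.Subsingleton → ∀ y, K.Separates A y

/-! ### Inclusions between the sets `after Y`. -/

theorem not_after_inl_subset_inr [Nontrivial K.Obj] (hK : K.SeparatesPairs sf)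
    {ψ : {ψ // ψ ∈ sf}} {v : M.frame.World} (hv : M.nSat ψ.1 v)
    (f : K.Obj) (C : {C // C ∈ sc}) :
    ¬ K.after (sf := sf) (.inl ψ) ⊆ K.after (sf := sf) (.inr (f, C)) := by
  obtain ⟨g, hg⟩ := exists_ne f
  obtain ⟨d, hd⟩ := M.dom_nonempty v
  obtain ⟨w', d', -, ⟨h, -⟩, hf⟩ := hK {.inr ψ} Set.subsingleton_singleton none v d hd
    ⟨by rintro _ rfl; exact hv, by simp⟩ g f hg
  intro hs
  obtain ⟨e, he, -⟩ := hs (show w' ∈ K.after (.inl ψ) from h _ rfl)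
  rw [hf] at he
  cases he

theorem not_after_inr_subset_inr (hK : K.SeparatesPairs sf) {f g : K.Obj}
    (hfg : f ≠ g) {C D : {C // C ∈ sc}}
    {v : M.frame.World} {d : M.Elem} (hd : d ∈ M.nExt C.1 v) :
    ¬ K.after (sf := sf) (.inr (f, C)) ⊆ K.after (sf := sf) (.inr (g, D)) := by
  obtain ⟨w', d', hf, ⟨h, -⟩, hg⟩ := hK {.inl C} Set.subsingleton_singleton none v d
    (M.nExt_subset_dom _ _ hd) ⟨by rintro _ rfl; exact hd, by simp⟩ f g hfg
  intro hs
  obtain ⟨e, he, -⟩ := hs (show w' ∈ K.after (.inr (f, C)) from ⟨d', hf, h _ rfl⟩)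
  rw [hg] at he
  cases he

/-- A world of `M` in the difference realizes the expression of `Y`. If `Z` concerns a formula or
the same object, its expression is made false along with it; if `Z` concerns an object that `Y` does
not mention, absence of that object makes `Z` false. The conclusion is independent of `w`, which
makes the choices of neighbourhoods at all worlds compatible. -/
theorem not_after_subset [Nontrivial K.Obj] (hK : K.SeparatesPairs sf)
    {w : K.World} {Y Z : K.Idx sf} (h : ¬ K.before w Y ⊆ K.before w Z) :
    ¬ K.after Y ⊆ K.after Z := by
  obtain ⟨v, hvY, hvZ⟩ := Set.not_subset.1 h
  rcases Y with ψ | ⟨f, C⟩ <;> rcases Z with χ | ⟨g, D⟩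
  · obtain ⟨f, g, hfg⟩ := exists_pair_ne K.Obj
    obtain ⟨d, hd⟩ := M.dom_nonempty v
    obtain ⟨w', d', -, ⟨h₁, h₂⟩, -⟩ := hK {.inr ψ} Set.subsingleton_singleton (some (.inr χ)) v d hd
      ⟨by rintro _ rfl; exact hvY, by rintro _ ⟨⟩; exact hvZ⟩ f g hfg
    exact fun hs => h₂ _ rfl (hs (show w' ∈ K.after (.inl ψ) from h₁ _ rfl))
  · exact not_after_inl_subset_inr hK hvY g D
  · obtain ⟨g, hg⟩ := exists_ne f
    obtain ⟨d, hf, hd⟩ := hvY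
    obtain ⟨w', d', hf', ⟨h₁, h₂⟩, -⟩ := hK {.inl C} Set.subsingleton_singleton (some (.inr χ)) v d
      (M.nExt_subset_dom _ _ hd)
      ⟨by rintro _ rfl; exact hd, by rintro _ ⟨⟩; exact hvZ⟩ f g hg.symm
    exact fun hs => h₂ _ rfl (hs (show w' ∈ K.after (.inr (f, C)) from ⟨d', hf', h₁ _ rfl⟩))
  · obtain ⟨d, hf, hd⟩ := hvY
    rcases eq_or_ne f g with rfl | hfg
    · obtain ⟨g, hg⟩ := exists_ne f
      obtain ⟨w', d', hf', ⟨h₁, h₂⟩, -⟩ := hK {.inl C} Set.subsingleton_singleton (some (.inl D)) v d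
        (M.nExt_subset_dom _ _ hd)
        ⟨by rintro _ rfl; exact hd, by rintro _ ⟨⟩; exact fun h' => hvZ ⟨d, hf, h'⟩⟩ f g hg.symm
      intro hs
      obtain ⟨e, he, h'⟩ := hs (show w' ∈ K.after (.inr (f, C)) from ⟨d', hf', h₁ _ rfl⟩)
      obtain rfl : d' = e := Option.some.inj (hf'.symm.trans he)
      exact h₂ _ rfl h'
    · exact not_after_inr_subset_inr hK hfg hd

theorem before_eq_of_after_eq [Nontrivial K.Obj] (hK : K.SeparatesPairs sf)
    {w : K.World} {Y Z : K.Idx sf} (h : K.after Y = K.after Z) :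
    K.before w Y = K.before w Z := by
  refine Set.Subset.antisymm ?_ ?_ <;> by_contra h'
  · exact not_after_subset hK h' h.subset
  · exact not_after_subset hK h' h.superset

/-- Every object is absent somewhere, so only a formula can hold at all new worlds. -/
theorem before_eq_univ_of_after_eq_univ [Nontrivial K.Obj] (hK : K.SeparatesPairs sf)
    {w : K.World} {Y : K.Idx sf} (h : K.after Y = Set.univ) :
    K.before w Y = Set.univ := by
  rcases Y with ψ | ⟨f, C⟩
  · by_contra h'
    obtain ⟨v, hv⟩ := (Set.ne_univ_iff_exists_notMem _).1 h'
    obtain ⟨f, g, hfg⟩ := exists_pair_ne K.Obj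
    obtain ⟨d, hd⟩ := M.dom_nonempty v
    obtain ⟨w', d', -, ⟨-, h₂⟩, -⟩ := hK ∅ Set.subsingleton_empty (some (.inr ψ)) v d hd
      ⟨by simp, by rintro _ ⟨⟩; exact hv⟩ f g hfg
    exact (h₂ _ rfl (h.superset (Set.mem_univ w'))).elim
  · obtain ⟨v⟩ := M.frame.nonempty
    obtain ⟨d, hd⟩ := M.dom_nonempty v
    obtain ⟨g, hg⟩ := exists_ne f
    obtain ⟨w', d', -, -, hf⟩ := hK ∅ Set.subsingleton_empty none v d hd ⟨by simp, by simp⟩ g f hg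
    obtain ⟨e, he, -⟩ := h.superset (Set.mem_univ w')
    rw [hf] at he
    cases he

/-! ### Faithful neighbourhoods for E, M and N. -/

theorem exists_faithful_E [Nontrivial K.Obj] (hK : K.SeparatesPairs sf) :
    ∃ N, (K.model N).frame.InClass .E ∧ K.Faithful sf I N := by
  refine ⟨fun i w => {α | ∃ Y : K.Idx sf, K.before w Y ∈ M.frame.nbhd i (K.proj w) ∧
    α = K.after Y}, trivial, fun i _ w Y => ⟨?_, fun h => ⟨Y, h, rfl⟩⟩⟩
  rintro ⟨Z, hZ, h⟩
  rwa [before_eq_of_after_eq hK h]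

theorem exists_faithful_M [Nontrivial K.Obj] (hK : K.SeparatesPairs sf)
    (hM : M.frame.InClass .M) :
    ∃ N, (K.model N).frame.InClass .M ∧ K.Faithful sf I N := by
  refine ⟨fun i w => {α | ∃ Y : K.Idx sf, K.before w Y ∈ M.frame.nbhd i (K.proj w) ∧
    K.after Y ⊆ α}, ?_, fun i _ w Y => ⟨?_, fun h => ⟨Y, h, subset_rfl⟩⟩⟩
  · rintro i w α β ⟨Y, hY, h⟩ hs
    exact ⟨Y, hY, h.trans hs⟩
  · rintro ⟨Z, hZ, h⟩
    refine hM i _ _ _ hZ ?_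
    by_contra h'
    exact not_after_subset hK h' h

theorem exists_faithful_N [Nontrivial K.Obj] (hK : K.SeparatesPairs sf)
    (hM : M.frame.InClass .N) :
    ∃ N, (K.model N).frame.InClass .N ∧ K.Faithful sf I N := by
  refine ⟨fun i w => {α | α = Set.univ ∨ ∃ Y : K.Idx sf, K.before w Y ∈ M.frame.nbhd i (K.proj w) ∧
    α = K.after Y}, fun i w => Or.inl rfl,
    fun i _ w Y => ⟨?_, fun h => Or.inr ⟨Y, h, rfl⟩⟩⟩
  rintro (h | ⟨Z, hZ, h⟩)
  · rw [before_eq_univ_of_after_eq_univ hK h]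
    exact hM i _
  · rwa [before_eq_of_after_eq hK h]

/-! ### Faithful neighbourhoods closed under intersection. -/

theorem _root_.NNMDL.Frame.ClosedUnderIntersection.biInter_mem {F : Frame.{u} n}
    (hF : F.ClosedUnderIntersection) {ι : Type*} {i : Fin n} {w : F.World} (g : ι → Set F.World)
    {s : Finset ι} (hs : s.Nonempty) (h : ∀ y ∈ s, g y ∈ F.nbhd i w) :
    ⋂ y ∈ s, g y ∈ F.nbhd i w := by
  induction hs using Finset.Nonempty.cons_induction with
  | singleton a => simpa using h
  | cons a s ha hs ih =>
    have : ⋂ y ∈ Finset.cons a s ha, g y = g a ∩ ⋂ y ∈ s, g y := by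
      ext; simp
    rw [this]
    exact hF i w _ _ (h a (by simp)) (ih fun y hy => h y (by simp [hy]))

/-- At each world where `∅` is not a neighbourhood in `M`, there is a world with all properties that
are neighbourhoods. -/
def HasWitness (K : Collapse M sc) (sf : Finset (NFormula n)) (I : Finset (Fin n)) : Prop :=
  ∀ i ∈ I, ∀ w : K.World, ∅ ∉ M.frame.nbhd i (K.proj w) →
    ∀ Z : K.Idx sf, K.before w Z ∈ M.frame.nbhd i (K.proj w) →
      ∃ u, ∀ Y : K.Idx sf, K.before w Y ∈ M.frame.nbhd i (K.proj w) → u ∈ K.after Y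

/-- Otherwise some world `v` of `M` lies in all `before w Y` with `Y ∈ s` but not in `before w Z`.
If `after Z` is non-empty, its inclusion in every `after Y` forces the members of `s` to be formulas
or to concern the object of `Z`. They then form a single pattern, and a new world realizing it
contradicts the equation. -/
theorem before_mem_of_biInter_after_eq [Nontrivial K.Obj]
    (hK : ∀ (A : Set ({C // C ∈ sc} ⊕ {ψ // ψ ∈ sf})) (y), K.Separates A y)
    (hW : K.HasWitness sf I) (hM : M.frame.ClosedUnderIntersection) {i : Fin n} (hi : i ∈ I)
    {w : K.World} {s : Finset (K.Idx sf)} (hs : s.Nonempty)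
    (hsN : ∀ Y ∈ s, K.before w Y ∈ M.frame.nbhd i (K.proj w)) {Z : K.Idx sf}
    (hZ : K.after Z = ⋂ Y ∈ s, K.after Y) :
    K.before w Z ∈ M.frame.nbhd i (K.proj w) := by
  have hK' : K.SeparatesPairs sf := fun A _ y => hK A y
  have hsub : ∀ Y ∈ s, K.after Z ⊆ K.after Y := fun Y hY =>
    hZ.subset.trans (Set.biInter_subset_of_mem hY)
  have hmem : ∀ u, (∀ Y ∈ s, u ∈ K.after Y) → u ∈ K.after Z := fun u hu =>
    hZ.superset (Set.mem_iInter₂.2 hu)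
  by_contra hZN
  have hne : ¬ ⋂ Y ∈ s, K.before w Y ⊆ K.before w Z := by
    intro h
    have : K.before w Z = ⋂ Y ∈ s, K.before w Y := by
      refine Set.Subset.antisymm (Set.subset_iInter₂ fun Y hY => ?_) h
      by_contra h'
      exact not_after_subset hK' h' (hsub Y hY)
    exact hZN (this ▸ hM.biInter_mem _ hs hsN)
  obtain ⟨v, hv, hvZ⟩ := Set.not_subset.1 hne
  have hv : ∀ Y ∈ s, v ∈ K.before w Y := Set.mem_iInter₂.1 hv
  -- Here separation says nothing, as `s` may mix objects. But `∅ = before w Z` is not a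
  -- neighbourhood, so a witness lies in the intersection.
  by_cases hempty : K.after Z = ∅ ∧ K.before w Z = ∅
  · obtain ⟨Y, hY⟩ := hs
    obtain ⟨u, hu⟩ := hW i hi w (hempty.2 ▸ hZN) Y (hsN Y hY)
    have := hmem u fun Y hY => hu Y (hsN Y hY)
    rw [hempty.1] at this
    exact this
  obtain ⟨d₀, hd₀⟩ := M.dom_nonempty v
  rcases Z with χ | ⟨g, D⟩
  · have hχ : ∃ x, M.nSat χ.1 x := by
      by_contra! h
      exact hempty ⟨Set.eq_empty_of_forall_notMem fun x => h _,
        Set.eq_empty_of_forall_notMem fun x => h _⟩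
    obtain ⟨x, hx⟩ := hχ
    have hinl : ∀ Y ∈ s, ∃ ψ, Y = .inl ψ := by
      rintro (ψ | ⟨f, C⟩) hY
      · exact ⟨ψ, rfl⟩
      · exact (not_after_inl_subset_inr hK' hx f C (hsub _ hY)).elim
    obtain ⟨f, g, hfg⟩ := exists_pair_ne K.Obj
    obtain ⟨w', d', -, ⟨h₁, h₂⟩, -⟩ := hK {x | ∃ ψ, x = .inr ψ ∧ .inl ψ ∈ s} (some (.inr χ)) v d₀ hd₀
      ⟨by rintro _ ⟨ψ, rfl, hψ⟩; exact hv _ hψ, by rintro _ ⟨⟩; exact hvZ⟩ f g hfg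
    refine h₂ _ rfl (hmem w' fun Y hY => ?_)
    obtain ⟨ψ, rfl⟩ := hinl Y hY
    exact h₁ _ ⟨ψ, rfl, hY⟩
  · have hD : ∃ x d, d ∈ M.nExt D.1 x := by
      by_contra! h
      refine hempty ⟨Set.eq_empty_of_forall_notMem ?_, Set.eq_empty_of_forall_notMem ?_⟩
      · rintro x ⟨d, -, hd⟩
        exact h _ d hd
      · rintro x ⟨d, -, hd⟩
        exact h _ d hd
    obtain ⟨x, d, hd⟩ := hD
    -- Some element of `M` belongs to `D`, so for any other object some new world has `g` in `D` and
    -- that object absent.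
    have hsg : ∀ Y ∈ s, (∃ ψ, Y = .inl ψ) ∨ ∃ C, Y = .inr (g, C) := by
      rintro (ψ | ⟨f, C⟩) hY
      · exact Or.inl ⟨ψ, rfl⟩
      · rcases eq_or_ne g f with rfl | hgf
        · exact Or.inr ⟨C, rfl⟩
        · exact (not_after_inr_subset_inr hK' hgf hd (hsub _ hY)).elim
    obtain ⟨f, hf⟩ := exists_ne g
    by_cases hC : ∃ C, (.inr (g, C) : K.Idx sf) ∈ s
    · obtain ⟨C, hC⟩ := hC
      obtain ⟨e, hge, heC⟩ := hv _ hC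
      obtain ⟨w', d', hg', ⟨h₁, h₂⟩, -⟩ := hK
        {x | (∃ ψ, x = .inr ψ ∧ .inl ψ ∈ s) ∨ ∃ C, x = .inl C ∧ .inr (g, C) ∈ s} (some (.inl D)) v e
        (M.nExt_subset_dom _ _ heC) ⟨by
          rintro _ (⟨ψ, rfl, hψ⟩ | ⟨C', rfl, hC'⟩)
          · exact hv _ hψ
          · obtain ⟨e', he', h'⟩ := hv _ hC'
            obtain rfl : e = e' := Option.some.inj (hge.symm.trans he')
            exact h', by
          rintro _ ⟨⟩
          exact fun h => hvZ ⟨e, hge, h⟩⟩ g f hf.symm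
      obtain ⟨d'', hd'', h⟩ := hmem w' fun Y hY => by
        obtain ⟨ψ, rfl⟩ | ⟨C', rfl⟩ := hsg Y hY
        · exact h₁ _ (Or.inl ⟨ψ, rfl, hY⟩)
        · exact ⟨d', hg', h₁ (.inl C') (Or.inr ⟨C', rfl, hY⟩)⟩
      obtain rfl : d' = d'' := Option.some.inj (hg'.symm.trans hd'')
      exact h₂ _ rfl h
    -- Only formulas occur in `s`, so a world where they hold and `g` is absent lies in the
    -- intersection but not in `after Z`.
    · obtain ⟨w', d', -, ⟨h₁, -⟩, hg⟩ := hK {x | ∃ ψ, x = .inr ψ ∧ .inl ψ ∈ s} none v d₀ hd₀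
        ⟨by rintro _ ⟨ψ, rfl, hψ⟩; exact hv _ hψ, by simp⟩ f g hf
      obtain ⟨d'', hd'', -⟩ := hmem w' fun Y hY => by
        obtain ⟨ψ, rfl⟩ | ⟨C', rfl⟩ := hsg Y hY
        · exact h₁ _ ⟨ψ, rfl, hY⟩
        · exact (hC ⟨C', hY⟩).elim
      rw [hg] at hd''
      cases hd''

theorem exists_faithful_C [Nontrivial K.Obj]
    (hK : ∀ (A : Set ({C // C ∈ sc} ⊕ {ψ // ψ ∈ sf})) (y), K.Separates A y)
    (hW : K.HasWitness sf I) (hM : M.frame.ClosedUnderIntersection) :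
    ∃ N, (K.model N).frame.InClass .C ∧ K.Faithful sf I N := by
  classical
  refine ⟨fun i w => {α | ∃ s : Finset (K.Idx sf), s.Nonempty ∧
    (∀ Y ∈ s, K.before w Y ∈ M.frame.nbhd i (K.proj w)) ∧ α = ⋂ Y ∈ s, K.after Y}, ?_,
    fun i hi w Y => ⟨?_, fun h => ⟨{Y}, by simp, by simpa, by simp⟩⟩⟩
  · rintro i w _ _ ⟨s, hs, hsN, rfl⟩ ⟨t, ht, htN, rfl⟩
    refine ⟨s ∪ t, hs.inl, fun Y hY => ?_, Finset.set_biInter_inter _ _ _ |>.symm⟩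
    exact (Finset.mem_union.1 hY).elim (hsN Y) (htN Y)
  · rintro ⟨s, hs, hsN, h⟩
    exact before_mem_of_biInter_after_eq hK hW hM hi hs hsN h

end Collapse

end NNMDL

namespace NNMDL

/-! ### Construction of a blueprint -/

namespace Blueprint

variable {n : ℕ}

/-- The objects: a type (a set of concepts), a class, and the level at which the object appears in
the trees of its class. -/
abbrev Obj (sc : Finset (NConcept n)) (L : ℕ) : Type :=
  Set {C // C ∈ sc} × (Fin 3 × Fin (L + 1))

/-- Atomic properties of objects, which tell any two objects apart. -/
abbrev Code (sc : Finset (NConcept n)) (L : ℕ) : Type :=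
  ({C // C ∈ sc} × Prop) ⊕ (Fin 3 × Fin (L + 1))

variable {sc : Finset (NConcept n)} {L : ℕ}

/-- `f` has the atomic property `k`. -/
def Obj.HasCode (f : Obj sc L) : Code sc L → Prop
  | .inl (C, b) => C ∈ f.1 ↔ b
  | .inr h => f.2 = h

/-- One bit of the type, or the tag, is enough to tell two objects apart; this keeps the number of
trees small although objects are exponentially many. -/
theorem Obj.exists_hasCode {f g : Obj sc L} (h : f ≠ g) : ∃ k, f.HasCode k ∧ ¬ g.HasCode k := by
  by_cases h₂ : f.2 = g.2
  · have h₁ : f.1 ≠ g.1 := fun h₁ => h (Prod.ext h₁ h₂)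
    obtain ⟨C, hC⟩ : ∃ C, ¬ (C ∈ f.1 ↔ C ∈ g.1) := by
      by_contra! h'
      exact h₁ (Set.ext h')
    exact ⟨.inl (C, C ∈ f.1), Iff.rfl, fun h' => hC (Iff.symm h')⟩
  · exact ⟨.inr f.2, rfl, fun h' => h₂ (Eq.symm h')⟩

end Blueprint

open Blueprint

variable {n : ℕ} (M : Model.{u, v} n) (sc : Finset (NConcept n))

/-- The set of concepts in `sc` to which an element belongs. -/
def Model.typeOf (w : M.frame.World) (d : M.Elem) : Set {C // C ∈ sc} := {C | d ∈ M.nExt C.1 w}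

open Classical in
/-- An element of a given type, if there is one. -/
noncomputable def Model.rep (w : M.frame.World) (t : Set {C // C ∈ sc}) : Option M.Elem :=
  if h : ∃ d ∈ M.dom w, M.typeOf sc w d = t then some h.choose else none

variable {M sc}

theorem Model.rep_spec {w : M.frame.World} {t : Set {C // C ∈ sc}} {d : M.Elem}
    (h : M.rep sc w t = some d) : d ∈ M.dom w ∧ M.typeOf sc w d = t := by
  unfold rep at h
  split_ifs at h with h'
  cases h
  exact h'.choose_spec

theorem Model.exists_rep {w : M.frame.World} {d : M.Elem} (hd : d ∈ M.dom w) :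
    ∃ d', M.rep sc w (M.typeOf sc w d) = some d' := by
  have h' : ∃ d' ∈ M.dom w, M.typeOf sc w d' = M.typeOf sc w d := ⟨d, hd, rfl⟩
  exact ⟨_, dif_pos h'⟩

variable {L : ℕ} {P J : Type} (point : P → M.frame.World × M.Elem)
  (next : M.frame.World → (Obj sc L → Option M.Elem) → J → M.frame.World)

open Classical in
/-- The world of `M` copied at a node of a tree, and the elements copied there by the objects. The
objects of the class of the tree appear at their level with their type; the others are present from
the root on, as copies of the given element, if they have the code of the tree. Later, an object
copies the same element as before if it still exists. -/
noncomputable def Blueprint.state (r : Code sc L × P × Fin 3) :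
    List J → M.frame.World × (Obj sc L → Option M.Elem)
  | [] => ((point r.2.1).1, fun f =>
      if f.2.1 = r.2.2 then (if f.2.2.val = 0 then M.rep sc (point r.2.1).1 f.1 else none)
      else if f.HasCode r.1 then some (point r.2.1).2 else none)
  | j :: σ =>
    let s := state r σ
    (next s.1 s.2 j, fun f =>
      if f.2.1 = r.2.2 ∧ f.2.2.val = σ.length + 1 then M.rep sc (next s.1 s.2 j) f.1
      else (s.2 f).filter (· ∈ M.dom (next s.1 s.2 j)))

namespace Blueprint

variable {point next}

theorem state_mem_dom (hpoint : ∀ p, (point p).2 ∈ M.dom (point p).1) {r : Code sc L × P × Fin 3}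
    {σ : List J} {f : Obj sc L} {d : M.Elem} (h : (state point next r σ).2 f = some d) :
    d ∈ M.dom (state point next r σ).1 := by
  cases σ with
  | nil =>
    simp only [state] at h ⊢
    split_ifs at h with h₁ h₂ h₃
    · exact (Model.rep_spec h).1
    · cases h
      exact hpoint _
  | cons j σ =>
    simp only [state] at h ⊢
    split_ifs at h with h₁
    · exact (Model.rep_spec h).1
    · simpa using (Option.filter_eq_some_iff.1 h).2

theorem state_level {r : Code sc L × P × Fin 3} {σ : List J} {f : Obj sc L} {d : M.Elem}
    (h : (state point next r σ).2 f = some d) (hf : f.2.1 = r.2.2) : f.2.2.val ≤ σ.length := by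
  induction σ generalizing d with
  | nil =>
    simp only [state, if_pos hf] at h
    split_ifs at h with h₂
    exact h₂.le
  | cons j σ ih =>
    simp only [state] at h
    split_ifs at h with h₁
    · exact h₁.2.le
    · exact (ih (Option.filter_eq_some_iff.1 h).1).trans (by simp)

/-- At depth `σ.length` the tree introduces a fresh batch of objects, one per type; the bound on the
length makes that level available. -/
theorem state_home {r : Code sc L × P × Fin 3} {σ : List J} (hσ : σ.length ≤ L) {d : M.Elem}
    (hd : d ∈ M.dom (state point next r σ).1) :
    ∃ f d', (state point next r σ).2 f = some d' ∧
      M.typeOf sc (state point next r σ).1 d' = M.typeOf sc (state point next r σ).1 d := by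
  obtain ⟨d', hd'⟩ := Model.exists_rep (sc := sc) hd
  refine ⟨(M.typeOf sc (state point next r σ).1 d, r.2.2, ⟨σ.length, by omega⟩), d', ?_,
    (Model.rep_spec hd').2⟩
  cases σ with
  | nil => simpa [state] using hd'
  | cons j σ => simpa [state] using hd'

/-- An object of the tree's class that is already present has level at most `σ.length`, so the next
batch does not overwrite it. -/
theorem state_cons_of_mem {r : Code sc L × P × Fin 3} {j : J} {σ : List J} {f : Obj sc L}
    {d : M.Elem} (h : (state point next r σ).2 f = some d)
    (hd : d ∈ M.dom (state point next r (j :: σ)).1) :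
    (state point next r (j :: σ)).2 f = some d := by
  have h₁ : ¬ (f.2.1 = r.2.2 ∧ f.2.2.val = σ.length + 1) := fun h₁ => by
    have := state_level h h₁.1
    omega
  simp only [state] at hd ⊢
  rw [if_neg h₁, Option.filter_eq_some_iff]
  exact ⟨h, by simpa using hd⟩

theorem rank_state_le {ρ : M.frame.World → ℕ} (hρ : ∀ w, ρ w ≤ L)
    (hnext : ∀ w e j, ρ (next w e j) ≤ ρ w - 1) (r : Code sc L × P × Fin 3) (σ : List J) :
    ρ (state point next r σ).1 ≤ L - σ.length := by
  induction σ with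
  | nil => exact hρ _
  | cons j σ ih =>
    have := hnext (state point next r σ).1 (state point next r σ).2 j
    simp only [state, List.length_cons]
    omega

variable (point next) in
/-- The blueprint whose worlds are the nodes of the trees. -/
noncomputable def collapse [Nonempty P] (hpoint : ∀ p, (point p).2 ∈ M.dom (point p).1) :
    Collapse M sc where
  World := (Code sc L × P × Fin 3) × {σ : List J // σ.length ≤ L}
  Obj := Obj sc L
  nonempty := ⟨((.inr (0, 0), Classical.arbitrary P, 0), ⟨[], Nat.zero_le _⟩)⟩
  proj w := (state point next w.1 w.2.1).1
  el w := (state point next w.1 w.2.1).2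
  mem_dom := state_mem_dom hpoint
  home {w d} hd := by
    obtain ⟨f, d', h, ht⟩ := state_home w.2.2 hd
    exact ⟨f, d', h, fun C hC => Set.ext_iff.1 ht ⟨C, hC⟩⟩

variable [Nonempty P] {hpoint : ∀ p, (point p).2 ∈ M.dom (point p).1}
  {sf : Finset (NFormula n)} {I : Finset (Fin n)}

instance : Nontrivial (collapse point next hpoint).Obj :=
  inferInstanceAs (Nontrivial (Set {C // C ∈ sc} × (Fin 3 × Fin (L + 1))))

/-- Two objects occupy at most two of the three classes. At the root of a tree of the remaining
class their presence is decided by the code alone, so a code of `f` that `g` lacks separates them.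
-/
theorem collapse_separates {A : Set ({C // C ∈ sc} ⊕ {ψ // ψ ∈ sf})}
    {y : Option ({C // C ∈ sc} ⊕ {ψ // ψ ∈ sf})} (p : P)
    (hp : ∀ w, ∀ d ∈ M.dom w, M.Realizes w d A y → M.Realizes (point p).1 (point p).2 A y) :
    (collapse point next hpoint).Separates A y := by
  intro w d hd h f g hfg
  obtain ⟨k, hf, hg⟩ := Obj.exists_hasCode (f := f) (g := g) hfg
  obtain ⟨a, haf, hag⟩ : ∃ a : Fin 3, f.2.1 ≠ a ∧ g.2.1 ≠ a := by
    generalize f.2.1 = x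
    generalize g.2.1 = y
    revert x y
    decide
  refine ⟨((k, p, a), ⟨[], Nat.zero_le _⟩), (point p).2, ?_, hp w d hd h, ?_⟩
  · change (state point next (k, p, a) []).2 f = _
    simp only [state]
    rw [if_neg haf, if_pos hf]
  · change (state point next (k, p, a) []).2 g = _
    simp only [state]
    rw [if_neg hag, if_neg hg]

/-- There are finitely many propositions, so the intersection of those that are neighbourhoods is a
neighbourhood and contains a world of smaller rank. When nothing needs a witness, a world of rank 0
keeps the rank bound valid. -/
theorem exists_next [Finite {C // C ∈ sc}] (hM : M.frame.ClosedUnderIntersection)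
    (ρ : M.frame.World → ℕ)
    (hzero : ∃ w, ρ w = 0)
    (hdrop : ∀ i w, ∀ α ∈ M.frame.nbhd i w, ∅ ∉ M.frame.nbhd i w → ∃ v ∈ α, ρ v < ρ w)
    (sf : Finset (NFormula n)) (w : M.frame.World) (e : Obj sc L → Option M.Elem) (i : Fin n) :
    ∃ v, ρ v ≤ ρ w - 1 ∧ (∅ ∉ M.frame.nbhd i w →
      ∀ Y : {ψ // ψ ∈ sf} ⊕ (Obj sc L × {C // C ∈ sc}),
        M.truthSet e Y ∈ M.frame.nbhd i w → v ∈ M.truthSet e Y) := by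
  classical
  by_cases h : ∅ ∉ M.frame.nbhd i w ∧ ∃ Y : {ψ // ψ ∈ sf} ⊕ (Obj sc L × {C // C ∈ sc}),
      M.truthSet e Y ∈ M.frame.nbhd i w
  · obtain ⟨h₀, Y₀, hY₀⟩ := h
    have hfin : {Y : {ψ // ψ ∈ sf} ⊕ (Obj sc L × {C // C ∈ sc}) |
      M.truthSet e Y ∈ M.frame.nbhd i w}.Finite := Set.toFinite _
    have hmem := hM.biInter_mem (fun Y => M.truthSet e Y) (s := hfin.toFinset)
      ⟨Y₀, hfin.mem_toFinset.2 hY₀⟩ fun Y hY => hfin.mem_toFinset.1 hY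
    obtain ⟨v, hv, hlt⟩ := hdrop i w _ hmem h₀
    exact ⟨v, by omega, fun _ Y hY => Set.mem_iInter₂.1 hv Y (hfin.mem_toFinset.2 hY)⟩
  · obtain ⟨v, hv⟩ := hzero
    exact ⟨v, by omega, fun h₀ Y hY => (h ⟨h₀, Y, hY⟩).elim⟩

/-- A world with a neighbourhood has positive rank, and rank is at most `L` minus depth, so the node
has a child. A denoted element lying in a concept at the child's world is in its domain, so its
object survives. -/
theorem collapse_hasWitness {idx : J → Fin n} (hidx : ∀ i ∈ I, ∃ j, idx j = i)
    {ρ : M.frame.World → ℕ} (hρ : ∀ w, ρ w ≤ L)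
    (hpos : ∀ i w, ∀ α ∈ M.frame.nbhd i w, 0 < ρ w)
    (hnext : ∀ w e j, ρ (next w e j) ≤ ρ w - 1)
    (hwit : ∀ w e j, ∅ ∉ M.frame.nbhd (idx j) w →
      ∀ Y : {ψ // ψ ∈ sf} ⊕ (Obj sc L × {C // C ∈ sc}),
        M.truthSet e Y ∈ M.frame.nbhd (idx j) w → next w e j ∈ M.truthSet e Y) :
    (collapse point next hpoint).HasWitness sf I := by
  rintro i hi ⟨r, σ, hσ⟩ h₀ Z hZ
  obtain ⟨j, rfl⟩ := hidx i hi
  have h₁ := hpos _ _ _ hZ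
  have h₂ : ρ (state point next r σ).1 ≤ L - σ.length := rank_state_le hρ hnext r σ
  have h₃ : σ.length + 1 ≤ L := by
    have : 0 < ρ (state point next r σ).1 := h₁
    omega
  refine ⟨(r, ⟨j :: σ, h₃⟩), fun Y hY => ?_⟩
  have h₄ := hwit _ _ j h₀ Y hY
  rcases Y with ψ | ⟨f, C⟩
  · exact h₄
  · obtain ⟨d, hd, hC⟩ := h₄
    exact ⟨d, state_cons_of_mem hd (M.nExt_subset_dom _ _ hC), hC⟩

/-- A list is encoded as a word of length `L` padded with `none`. -/
theorem card_lists_le (J : Type) [Finite J] (L : ℕ) :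
    Finite {σ : List J // σ.length ≤ L} ∧
      Nat.card {σ : List J // σ.length ≤ L} ≤ (Nat.card J + 1) ^ L := by
  let F : {σ : List J // σ.length ≤ L} → (Fin L → Option J) := fun σ m => σ.1[m.val]?
  have hF : Function.Injective F := by
    rintro ⟨σ, hσ⟩ ⟨τ, hτ⟩ h
    refine Subtype.ext (List.ext_getElem? fun m => ?_)
    by_cases hm : m < L
    · exact congrFun h ⟨m, hm⟩
    · rw [List.getElem?_eq_none (show σ.length ≤ m by omega),
        List.getElem?_eq_none (show τ.length ≤ m by omega)]
  refine ⟨Finite.of_injective F hF, (Nat.card_le_card_of_injective F hF).trans ?_⟩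
  simp [Nat.card_fun, Finite.card_option]

theorem card_obj (sc : Finset (NConcept n)) (L : ℕ) :
    Nat.card (Obj sc L) = 2 ^ sc.card * (3 * (L + 1)) := by
  simp [Nat.card_eq_fintype_card]

theorem card_code (sc : Finset (NConcept n)) (L : ℕ) :
    Nat.card (Code sc L) = sc.card * 2 + 3 * (L + 1) := by
  simp [Nat.card_eq_fintype_card]

end Blueprint

/-! ### The bounds -/

/-- A pattern that is never realized gets an arbitrary point, as separation then demands nothing. -/
theorem exists_point {M : Model.{u, v} n} {sc : Finset (NConcept n)} {sf : Finset (NFormula n)}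
    (A : Set ({C // C ∈ sc} ⊕ {ψ // ψ ∈ sf})) (y : Option ({C // C ∈ sc} ⊕ {ψ // ψ ∈ sf})) :
    ∃ x : M.frame.World × M.Elem, x.2 ∈ M.dom x.1 ∧
      ∀ w, ∀ d ∈ M.dom w, M.Realizes w d A y → M.Realizes x.1 x.2 A y := by
  by_cases h : ∃ w, ∃ d ∈ M.dom w, M.Realizes w d A y
  · obtain ⟨w, d, hd, h⟩ := h
    exact ⟨(w, d), hd, fun _ _ _ _ => h⟩
  · obtain ⟨w⟩ := M.frame.nonempty
    obtain ⟨d, hd⟩ := M.dom_nonempty w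
    exact ⟨(w, d), hd, fun w d hd h' => (h ⟨w, d, hd, h'⟩).elim⟩

/-- A model of `φ` in the class of `L` with bounds on the number of worlds and the domains. -/
def HasBoundedModel (L : Logic) (φ : Formula n) (a b : ℕ) : Prop :=
  ∃ M : Model.{0, 0} n, M.frame.InClass L ∧ M.Satisfies φ ∧ Finite M.frame.World ∧
    Nat.card M.frame.World ≤ a ∧ ∀ w, (M.dom w).Finite ∧ (M.dom w).ncard ≤ b

theorem Collapse.Faithful.hasBoundedModel {L : Logic} {φ : Formula n}
    {K : Collapse M φ.nf.clCon} {N : Fin n → K.World → Set (Set K.World)}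
    (hN : K.Faithful φ.nf.clSubs φ.nf.indices N) (hL : (K.model N).frame.InClass L)
    (hφ : ∃ w, M.nSat φ.nf (K.proj w)) [Finite K.World] [Finite K.Obj] :
    HasBoundedModel L φ (Nat.card K.World) (Nat.card K.Obj) := by
  obtain ⟨w, hw⟩ := hφ
  refine ⟨K.model N, hL, ⟨w, ?_⟩, ‹_›, le_rfl, fun w => ?_⟩
  · refine (Model.nSat_nf _ _ _).1 ?_
    exact (hN.nSat_iff φ.nf.isClosed (Finset.mem_union_left _ (NFormula.mem_subs_self _)) w).2 hw
  · have : Finite (K.model N).Elem := ‹Finite K.Obj›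
    exact ⟨Set.toFinite _, Set.ncard_le_card _⟩

end NNMDL

namespace NNMDL

open Blueprint

variable {n : ℕ} {M : Model.{u, v} n}

/-! ### Counting worlds and objects. -/

theorem HasBoundedModel.mono {L : Logic} {φ : Formula n} {a b a' b' : ℕ}
    (h : HasBoundedModel L φ a b) (ha : a ≤ a') (hb : b ≤ b') : HasBoundedModel L φ a' b' := by
  obtain ⟨M, hL, hφ, hfin, hw, hd⟩ := h
  exact ⟨M, hL, hφ, hfin, hw.trans ha, fun w => ⟨(hd w).1, (hd w).2.trans hb⟩⟩

theorem Collapse.Separates.exists_nSat {sc : Finset (NConcept n)} {sf : Finset (NFormula n)}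
    {K : Collapse M sc} [Nontrivial K.Obj] {ψ : NFormula n} (hψ : ψ ∈ sf)
    (hK : K.Separates (sf := sf) {.inr ⟨ψ, hψ⟩} none) (h : ∃ w, M.nSat ψ w) :
    ∃ w, M.nSat ψ (K.proj w) := by
  obtain ⟨w, hw⟩ := h
  obtain ⟨d, hd⟩ := M.dom_nonempty w
  obtain ⟨f, g, hfg⟩ := exists_pair_ne K.Obj
  obtain ⟨w', d', -, ⟨h, -⟩, -⟩ := hK w d hd ⟨by rintro _ rfl; exact hw, by simp⟩ f g hfg
  exact ⟨w', h _ rfl⟩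

theorem Blueprint.card_expr_le (φ : NFormula n) :
    Nat.card ({C // C ∈ φ.clCon} ⊕ {ψ // ψ ∈ φ.clSubs}) ≤ φ.Fg.card := by
  simpa [Nat.card_sum] using φ.card_cl_le

theorem Blueprint.card_clCon_le (φ : NFormula n) : φ.clCon.card ≤ φ.Fg.card :=
  (Nat.le_add_right _ _).trans φ.card_cl_le

theorem Blueprint.finite_card_collapse_world {sc : Finset (NConcept n)} {L : ℕ} {P J : Type}
    [Nonempty P] [Finite P] [Finite J] {point : P → M.frame.World × M.Elem}
    {next : M.frame.World → (Obj sc L → Option M.Elem) → J → M.frame.World}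
    {hpoint : ∀ p, (point p).2 ∈ M.dom (point p).1} :
    Finite (collapse point next hpoint).World ∧ Nat.card (collapse point next hpoint).World ≤
      (sc.card * 2 + 3 * (L + 1)) * (Nat.card P * 3) * (Nat.card J + 1) ^ L := by
  obtain ⟨hfin, hle⟩ := card_lists_le J L
  refine ⟨inferInstanceAs (Finite ((Code sc L × P × Fin 3) × {σ : List J // σ.length ≤ L})), ?_⟩
  change Nat.card ((Code sc L × P × Fin 3) × {σ : List J // σ.length ≤ L}) ≤ _
  rw [Nat.card_prod, Nat.card_prod, Nat.card_prod, card_code, Nat.card_fin]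
  exact Nat.mul_le_mul le_rfl hle

theorem hasBoundedModel_of_ne_C {L : Logic} (hC : L ≠ .C) {φ : Formula n} (hL : M.frame.InClass L)
    (hφ : M.Satisfies φ) :
    HasBoundedModel L φ ((φ.Fg.card * 2 + 3) * ((φ.Fg.card + 1) ^ 2 * 3)) (2 ^ φ.Fg.card * 3) := by
  let X := {C // C ∈ φ.nf.clCon} ⊕ {ψ // ψ ∈ φ.nf.clSubs}
  have hpt : ∀ p : Option X × Option X, ∃ x : M.frame.World × M.Elem, x.2 ∈ M.dom x.1 ∧
      ∀ w, ∀ d ∈ M.dom w, M.Realizes w d {z | z ∈ p.1} p.2 →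
        M.Realizes x.1 x.2 {z | z ∈ p.1} p.2 := fun p => exists_point _ _
  choose point hpoint hreal using hpt
  -- No witnesses are needed here, so every tree is just its root.
  let K := collapse (sc := φ.nf.clCon) (L := 0) (J := Empty) point (fun w _ _ => w) hpoint
  have hK : K.SeparatesPairs φ.nf.clSubs := by
    intro A hA y
    obtain ⟨o, rfl⟩ : ∃ o : Option X, A = {z | z ∈ o} := by
      rcases hA.eq_empty_or_singleton with rfl | ⟨x, rfl⟩
      · exact ⟨none, by ext; simp⟩
      · exact ⟨some x, by ext; simp [eq_comm]⟩
    exact collapse_separates (o, y) (hreal (o, y))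
  obtain ⟨N, hN, hfaith⟩ : ∃ N, (K.model N).frame.InClass L ∧
      K.Faithful φ.nf.clSubs φ.nf.indices N := by
    cases L with
    | E => exact Collapse.exists_faithful_E hK
    | M => exact Collapse.exists_faithful_M hK hL
    | C => exact (hC rfl).elim
    | N => exact Collapse.exists_faithful_N hK hL
  obtain ⟨hfin, hcard⟩ : Finite K.World ∧ _ := finite_card_collapse_world
  have : Finite K.Obj := inferInstanceAs (Finite (Obj φ.nf.clCon 0))
  have hmem : φ.nf ∈ φ.nf.clSubs := Finset.mem_union_left _ (NFormula.mem_subs_self _)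
  refine (hfaith.hasBoundedModel hN ((hK _ Set.subsingleton_singleton none).exists_nSat hmem
    (hφ.imp fun w hw => (M.nSat_nf φ w).2 hw))).mono ?_ ?_
  · refine hcard.trans ?_
    have h₁ := card_expr_le φ.nf
    have h₂ := card_clCon_le φ.nf
    rw [pow_zero, mul_one, Nat.card_prod, Finite.card_option, ← sq]
    exact Nat.mul_le_mul (by unfold Formula.Fg; omega)
      (Nat.mul_le_mul (Nat.pow_le_pow_left (Nat.add_le_add_right h₁ 1) 2) le_rfl)
  · refine (card_obj φ.nf.clCon 0).le.trans ?_
    exact Nat.mul_le_mul (Nat.pow_le_pow_right (by norm_num) (card_clCon_le φ.nf)) le_rfl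

theorem hasBoundedModel_of_rank {φ : Formula n} {L : ℕ} (hM : M.frame.ClosedUnderIntersection)
    (hφ : ∃ w, M.nSat φ.nf w) {ρ : M.frame.World → ℕ} (hρ : ∀ w, ρ w ≤ L)
    (hzero : ∃ w, ρ w = 0)
    (hpos : ∀ i w, ∀ α ∈ M.frame.nbhd i w, 0 < ρ w)
    (hdrop : ∀ i w, ∀ α ∈ M.frame.nbhd i w, ∅ ∉ M.frame.nbhd i w → ∃ v ∈ α, ρ v < ρ w) :
    HasBoundedModel .C φ ((φ.Fg.card * 2 + 3 * (L + 1)) *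
      (2 ^ φ.Fg.card * (φ.Fg.card + 1) * 3) * (φ.Fg.card + 1) ^ L)
      (2 ^ φ.Fg.card * (3 * (L + 1))) := by
  let X := {C // C ∈ φ.nf.clCon} ⊕ {ψ // ψ ∈ φ.nf.clSubs}
  have hpt : ∀ p : Set X × Option X, ∃ x : M.frame.World × M.Elem, x.2 ∈ M.dom x.1 ∧
      ∀ w, ∀ d ∈ M.dom w, M.Realizes w d p.1 p.2 → M.Realizes x.1 x.2 p.1 p.2 :=
    fun p => exists_point _ _
  choose point hpoint hreal using hpt
  -- Trees branch only over the modal indices occurring in `φ`, so the bound does not depend on `n`.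
  choose next hnext hwit using fun w (e : Obj φ.nf.clCon L → Option M.Elem)
    (j : {i // i ∈ φ.nf.indices}) => exists_next hM ρ hzero hdrop φ.nf.clSubs w e j.1
  let K := collapse point next hpoint
  have hK : ∀ (A : Set X) (y), K.Separates A y := fun A y =>
    collapse_separates (A, y) (hreal (A, y))
  have hW : K.HasWitness φ.nf.clSubs φ.nf.indices :=
    collapse_hasWitness (idx := Subtype.val) (fun i hi => ⟨⟨i, hi⟩, rfl⟩) hρ hpos hnext hwit
  obtain ⟨N, hN, hfaith⟩ := Collapse.exists_faithful_C hK hW hM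
  obtain ⟨hfin, hcard⟩ : Finite K.World ∧ _ := finite_card_collapse_world
  have : Finite K.Obj := inferInstanceAs (Finite (Obj φ.nf.clCon L))
  have hmem : φ.nf ∈ φ.nf.clSubs := Finset.mem_union_left _ (NFormula.mem_subs_self _)
  have h₂ := card_clCon_le φ.nf
  refine (hfaith.hasBoundedModel hN ((hK _ none).exists_nSat hmem hφ)).mono ?_ ?_
  · refine hcard.trans ?_
    have h₁ := card_expr_le φ.nf
    have h₃ := φ.nf.card_indices_le
    rw [Nat.card_prod, Finite.card_option, Nat.card_eq_fintype_card (α := Set X), Fintype.card_set,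
      ← Nat.card_eq_fintype_card, Nat.card_eq_fintype_card (α := {i // i ∈ φ.nf.indices}),
      Fintype.card_coe]
    unfold Formula.Fg
    gcongr
    norm_num
  · refine (card_obj φ.nf.clCon L).le.trans ?_
    unfold Formula.Fg
    gcongr
    norm_num

theorem hasBoundedModel_C {φ : Formula n} (hM : M.frame.ClosedUnderIntersection)
    (hφ : M.Satisfies φ) :
    HasBoundedModel .C φ ((φ.Fg.card * 2 + 3 * (φ.Fg.card + 1)) *
      (2 ^ φ.Fg.card * (φ.Fg.card + 1) * 3) * (φ.Fg.card + 1) ^ φ.Fg.card)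
      (2 ^ φ.Fg.card * (3 * (φ.Fg.card + 1))) := by
  obtain ⟨w, hw⟩ := hφ
  have hdepth : φ.nf.depth ≤ φ.Fg.card := by
    refine φ.nf.depth_le_card.trans (le_trans (Nat.add_le_add ?_ ?_) φ.nf.card_cl_le) <;>
      exact Finset.card_le_card Finset.subset_union_left
  refine hasBoundedModel_of_rank (M := M.strat φ.Fg.card) (ρ := fun w => w.2.val)
    (M.strat_closedUnderIntersection _ hM)
    ⟨(w, Fin.last _), (M.strat_nSat _ _ _ (by simpa using hdepth)).2 ((M.nSat_nf φ w).2 hw)⟩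
    (fun w => Nat.lt_succ_iff.1 w.2.2) ⟨(w, 0), rfl⟩ ?_ ?_
  · rintro i w α ⟨j, hj, -⟩
    omega
  · rintro i w α ⟨j, hj, hα⟩ h₀
    -- If this slice were empty it would coincide with the slice of `∅`, and `∅` would be a
    -- neighbourhood too.
    have hne : ({v | (v, j) ∈ α} : Set M.frame.World).Nonempty := by
      by_contra hempty
      rw [Set.not_nonempty_iff_eq_empty] at hempty
      exact h₀ ⟨j, hj, (congrArg (· ∈ M.frame.nbhd i w.1) hempty).mp hα⟩
    obtain ⟨v, hv⟩ := hne
    exact ⟨(v, j), hv, by simp only; omega⟩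

end NNMDL

theorem mainTheorem6 :
    ∃ p q : Polynomial ℕ,
      ∀ (n : ℕ) (L : NNMDL.Logic) (φ : NNMDL.Formula n),
        NNMDL.Satisfiable.{u, v} L φ →
          ∃ M : NNMDL.Model.{0, 0} n,
            M.frame.InClass L ∧
            M.Satisfies φ ∧
            Finite M.frame.World ∧
            (L ≠ NNMDL.Logic.C → Nat.card M.frame.World ≤ p.eval φ.Fg.card) ∧
            (L = NNMDL.Logic.C → Nat.card M.frame.World ≤ 2 ^ p.eval φ.Fg.card) ∧
            ∀ w : M.frame.World,
              (M.dom w).Finite ∧ (M.dom w).ncard ≤ 2 ^ q.eval φ.Fg.card := by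
  -- The first summand of `p` counts the worlds for E, M and N; the second is the exponent for C,
  -- namely `(5m + 3) + (2m + 2) + m ^ 2`, obtained from `k + 1 ≤ 2 ^ k`. Adding them lets one
  -- polynomial serve both cases.
  refine ⟨(Polynomial.X * 2 + 3) * ((Polynomial.X + 1) ^ 2 * 3) +
    (Polynomial.X ^ 2 + 7 * Polynomial.X + 5), 2 * Polynomial.X + 2, ?_⟩
  rintro n L φ ⟨M, hL, hφ⟩
  simp only [Polynomial.eval_add, Polynomial.eval_mul, Polynomial.eval_pow, Polynomial.eval_X,
    Polynomial.eval_ofNat, Polynomial.eval_one]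
  generalize hm : φ.Fg.card = m
  have h2 : ∀ k : ℕ, k + 1 ≤ 2 ^ k := fun k => Nat.lt_two_pow_self
  by_cases hC : L = .C
  · subst hC
    obtain ⟨M', hL', hφ', hfin, hw, hd⟩ := NNMDL.hasBoundedModel_C hL hφ
    rw [hm] at hw hd
    refine ⟨M', hL', hφ', hfin, fun h => (h rfl).elim, fun _ => hw.trans ?_,
      fun w => ⟨(hd w).1, (hd w).2.trans ?_⟩⟩
    · calc (m * 2 + 3 * (m + 1)) * (2 ^ m * (m + 1) * 3) * (m + 1) ^ m
          ≤ 2 ^ (5 * m + 3) * (2 ^ m * 2 ^ m * 2 ^ 2) * (2 ^ m) ^ m := by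
            gcongr
            · have := h2 (5 * m + 3)
              omega
            · exact h2 m
            · norm_num
            · exact h2 m
        _ = 2 ^ (m ^ 2 + 7 * m + 5) := by ring
        _ ≤ _ := Nat.pow_le_pow_right (by norm_num) (Nat.le_add_left _ _)
    · calc 2 ^ m * (3 * (m + 1)) ≤ 2 ^ m * (2 ^ 2 * 2 ^ m) := by
            gcongr
            · norm_num
            · exact h2 m
        _ = 2 ^ (2 * m + 2) := by ring
  · obtain ⟨M', hL', hφ', hfin, hw, hd⟩ := NNMDL.hasBoundedModel_of_ne_C hC hL hφ
    rw [hm] at hw hd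
    refine ⟨M', hL', hφ', hfin, fun _ => hw.trans (Nat.le_add_right _ _), fun h => (hC h).elim,
      fun w => ⟨(hd w).1, (hd w).2.trans ?_⟩⟩
    calc 2 ^ m * 3 ≤ 2 ^ m * 2 ^ 2 := by gcongr; norm_num
      _ = 2 ^ (m + 2) := by ring
      _ ≤ _ := Nat.pow_le_pow_right (by norm_num) (by omega)
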